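/- **Setting.** Let $N\ge 1$, $\mathbb R^n=\mathbb R^{n_1}\times\dots\times\mathbb R^{n_N}$ with the Euclidean norm, write $x=(x_1,\dots,x_N)$, and let $x+U_i(z-x_i)$ denote $x$ with its $i$-th block replaced by $z\in\mathbb R^{n_i}$. Functions take values in $\mathbb R\cup\{\infty\}$ when proper, $\operatorname{dom}\varphi=\{\varphi<\infty\}$, and $\partial\varphi$ is the limiting subdifferential: for $\varphi(x)$ finite, $v\in\partial\varphi(x)$ iff $v=\lim v^k$ with $v^k$ a regular (Fréchet) subgradient of $\varphi$ at $x^k$, $x^k\to x$, $\varphi(x^k)\to\varphi(x)$; where $\varphi$ is not finite, $\partial\varphi$ is empty. A point $x$ is *stationary* for $\varphi$ if $0\in\partial\varphi(x)$. Let $h:\mathbb R^n\to\mathbb R\cup\{\infty\}$ be proper, lsc, with $\operatorname{int}\operatorname{dom}h\ne\emptyset$ and $h\in C^1(\operatorname{int}\operatorname{dom}h)$. It is *$i$-th block (strictly / $\sigma$-strongly) convex* if $z\mapsto h(x+U_i(z-x_i))$ is so for every $x\in\operatorname{dom}h$; an *$i$-th block kernel* if it is $i$-th block convex and $h(x+U_i(z-x_i))/\|z\|\to\infty$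 as $\|z\|\to\infty$ for every $x\in\operatorname{dom} h$; *$i$-th block Legendre* if it is $i$-th block strictly convex and $\|\nabla_i h(u^k)\|\to\infty$ for every sequence $u^k\in\operatorname{int}\operatorname{dom}h$ converging to a boundary point of $\operatorname{dom}h$. Put $D_h(y,x)=h(y)-h(x)-\langle\nabla h(x),y-x\rangle$ if $y\in\operatorname{dom}h$, $x\in\operatorname{int}\operatorname{dom}h$, and $D_h(y,x)=\infty$ otherwise. Consider minimizing $\Phi(x)=f(x)+\sum_{i=1}^N g_i(x_i)$ over $\overline C$, with $C\subseteq\mathbb R^n$ nonempty, open and convex, where * each $g_i:\mathbb R^{n_i}\to\mathbb R\cup\{\infty\}$ is proper and lsc, and $C$ contains a point $x$ with $\sum_i g_i(x_i)<\infty$; * each $h_i:\mathbb R^n\to\mathbb R\cup\{\infty\}$ is an $i$-th block kernel and $i$-th block Legendre, $\operatorname{int}\operatorname{dom}h_1=\dots=\operatorname{int}\operatorname{dom}h_N$, and $\overline C\subseteq\operatorname{int}\operatorname{dom}h_1$; * $f:\mathbb R^n\to\mathbb R\cup\{\infty\}$ is proper, lsc, finite and $C^1$ on $\operatorname{int}\operatorname{dom}h_1$,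 and $(L_1,\dots,L_N)$-smooth relative to $(h_1,\dots,h_N)$ with $L_i>0$, i.e. for each $i$ and $x\in\operatorname{int}\operatorname{dom}h_i$ the function $z\mapsto (L_ih_i-f)(x+U_i(z-x_i))$ is convex on $\{z: x+U_i(z-x_i)\in\operatorname{int}\operatorname{dom}h_i\}$; * $\Phi$ attains its minimum over $\overline C$. **Algorithm (BIBPA).** For $x,y\in\operatorname{int}\operatorname{dom}h_1$ let $$T_i^{k}(x,y)=\operatorname*{argmin}_{z\in\mathbb R^{n_i}}\ \Big\langle\nabla_if(x)-\tfrac{\alpha_i^k}{\gamma_i^k}(x_i-y_i),\,z-x_i\Big\rangle+\tfrac1{\gamma_i^k}D_{h_i}(x+U_i(z-x_i),x)+g_i(z)$$ (minimizers have a finite value). Write $x^{k,i}=(x_1^{k+1},\dots,x_i^{k+1},x_{i+1}^k,\dots,x_N^k)$. Let $x^{-1},x^0\in\operatorname{int}\operatorname{dom}h_1$ and let $(x^k)$ satisfy $x_i^{k+1}\in T_i^k(x^{k,i-1},x^{k-1})$ for all $k\ge0$, $i=1,\dots,N$. Assume that, whenever $\gamma_i^k\in(0,1/L_i)$, one has $x+U_i(z-x_i)\in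 C$ for all $x,y\in\operatorname{int}\operatorname{dom}h_1$ and $z\in T_i^k(x,y)$. Let $h_i$ be $\sigma_i$-strongly convex in its $i$-th block with $\sigma_i>0$, and let the parameters satisfy, for all $i$ and $k$: $\alpha_i^k\to\alpha_i$ as $k\to\infty$, $|\alpha_i^k|<\sigma_i/2$, $$0<\gamma_i\le\tfrac{\sigma_i-2|\alpha_i|}{\sigma_iL_i},\qquad \gamma_i\le\gamma_i^k\le\tfrac{\sigma_i-2|\alpha_i^k|}{\sigma_iL_i},$$ $$a_i^k:=\tfrac{1-\gamma_i^kL_i}{\gamma_i^k}-\tfrac{|\alpha_i^k|}{\sigma_i\gamma_i^k}-\delta_i\ge0,\qquad b_i^k:=\delta_i-\tfrac{|\alpha_i^k|}{\sigma_i\gamma_i^k}\ge0,$$ and there is $\varrho>0$ with $a_i^k+b_i^{k+1}\ge\varrho$ for all $i,k$ (for instance, this holds if all $a_i^k$ and $b_i^k$ are bounded below by one positive constant). **Theorem (global convergence).** In this setting suppose further that, for every $i$, $\nabla_if$ and $\nabla_ih_i$ are locally Lipschitz on $\operatorname{int}\operatorname{dom}h_1$, that the partial Hessian $\nabla^2_{ii}h_i$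 exists on $\operatorname{int}\operatorname{dom}h_1$ and is bounded on every bounded set whose closure lies in $\operatorname{int}\operatorname{dom}h_1$, and that $(x^k)$ is bounded. Suppose that the Lyapunov function on $\mathbb R^n\times\mathbb R^n$, $$\mathcal L(x,y)=\Phi(x)+\sum_{i=1}^N\delta_i\,D_{h_i}\big((x_1,\dots,x_i,y_{i+1},\dots,y_N),(x_1,\dots,x_{i-1},y_i,\dots,y_N)\big)\qquad(0\cdot\infty=0),$$ is a Kurdyka–Łojasiewicz function: for each $p^\star$ with $\partial\mathcal L(p^\star)\ne\emptyset$ there are $\eta,\varepsilon>0$ and a concave $\psi:[0,\eta]\to[0,\infty)$ with $\psi(0)=0$, $\psi$ being $C^1$ and positive on $(0,\eta)$, such that $\psi'(\mathcal L(p)-\mathcal L(p^\star))\operatorname{dist}(0,\partial\mathcal L(p))\ge1$ whenever $\|p-p^\star\|<\varepsilon$ and $\mathcal L(p^\star)<\mathcal L(p)<\mathcal L(p^\star)+\eta$ (with $\operatorname{dist}(0,\emptyset)=\infty$). Then 1. $\sum_{k}\|x_i^{k+1}-x_i^k\|<\infty$ for every $i=1,\dots,N$; 2. the whole sequence $(x^k)$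 converges to a stationary point $x^\star$ of $\Phi$, i.e. $0\in\partial\Phi(x^\star)$. -/

import Mathlib

open Filter Topology Set

noncomputable section

namespace BIBPA

/-! ### Extended-real-valued functions and subdifferentials -/

section Extended

/-- The effective domain of an extended-real-valued function. -/
def dom {F : Type*} (φ : F → EReal) : Set F := {x | φ x < ⊤}

/-- Properness: nowhere `-∞` and not identically `+∞`. -/
def IsProper {F : Type*} (φ : F → EReal) : Prop :=
  (∀ x, φ x ≠ ⊥) ∧ ∃ x, φ x ≠ ⊤

variable {F : Type*} [NormedAddCommGroup F] [InnerProductSpace ℝ F]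

/-- Regular (Fréchet) subgradients: `φ x` is finite and
`φ z ≥ φ x + ⟪v, z - x⟫ + o(‖z - x‖)` as `z → x`. -/
def regularSubdiff (φ : F → EReal) (x : F) : Set F :=
  {v | φ x ≠ ⊤ ∧ φ x ≠ ⊥ ∧ ∀ ε : ℝ, 0 < ε → ∀ᶠ z in 𝓝 x,
    (((φ x).toReal + inner ℝ v (z - x) - ε * ‖z - x‖ : ℝ) : EReal) ≤ φ z}

/-- The (limiting) subdifferential `∂φ(x)`; it is empty where `φ` is not finite. -/
def subdiff (φ : F → EReal) (x : F) : Set F :=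
  {v | φ x ≠ ⊤ ∧ φ x ≠ ⊥ ∧ ∃ (u : ℕ → F) (w : ℕ → F),
    Tendsto u atTop (𝓝 x) ∧ Tendsto (fun k => φ (u k)) atTop (𝓝 (φ x)) ∧
    (∀ k, w k ∈ regularSubdiff φ (u k)) ∧ Tendsto w atTop (𝓝 v)}

/-- Stationary (critical) points: `0 ∈ ∂φ(x)`. -/
def IsStationary (φ : F → EReal) (x : F) : Prop := (0 : F) ∈ subdiff φ x

/-- The Kurdyka–Łojasiewicz property of `φ` at `xs`. The distance to the subdifferential is the
extended one, so it is `∞` where the subdifferential is empty. -/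
def HasKLProperty (φ : F → EReal) (xs : F) : Prop :=
  φ xs ≠ ⊤ ∧ φ xs ≠ ⊥ ∧
  ∃ (η ε : ℝ) (ψ : ℝ → ℝ), 0 < η ∧ 0 < ε ∧
    ConcaveOn ℝ (Icc 0 η) ψ ∧ (∀ s ∈ Icc 0 η, 0 ≤ ψ s) ∧ ψ 0 = 0 ∧
    ContDiffOn ℝ 1 ψ (Ioo 0 η) ∧ (∀ s ∈ Ioo 0 η, 0 < ψ s) ∧
    ∀ x ∈ Metric.ball xs ε, φ xs < φ x → φ x < φ xs + (η : EReal) →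
      1 ≤ ENNReal.ofReal (deriv ψ ((φ x).toReal - (φ xs).toReal)) *
        Metric.infEDist (0 : F) (subdiff φ x)

/-- KŁ functions: the KŁ property holds at each point of `dom ∂φ`. -/
def IsKLFunction (φ : F → EReal) : Prop :=
  ∀ x, (subdiff φ x).Nonempty → HasKLProperty φ x

end Extended

/-! ### Block structure -/

variable {N : ℕ} {n : Fin N → ℕ}

/-- `ℝⁿ = ℝ^{n₁} × ⋯ × ℝ^{n_N}` with its Euclidean norm. -/
abbrev Space (n : Fin N → ℕ) : Type :=
  PiLp 2 (fun i : Fin N => EuclideanSpace ℝ (Fin (n i)))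

/-- `x + U_i (z - x_i)`: the point `x` with its `i`-th block replaced by `z`. -/
def setBlock (x : Space n) (i : Fin N) (z : EuclideanSpace ℝ (Fin (n i))) : Space n :=
  WithLp.toLp 2 (Function.update (WithLp.ofLp x) i z)

/-- `(x_1, …, x_m, y_{m+1}, …, y_N)`: the first `m` blocks of `x`, the other blocks of `y`. With
`x = x^{k+1}` and `y = x^k` this is `x^{k,m}`. As `Fin N` counts from zero, for `i : Fin N` the
point before (after) the `i`-th block has been replaced is `mix i x y` (`mix (i + 1) x y`). -/
def mix (m : ℕ) (x y : Space n) : Space n :=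
  WithLp.toLp 2 (fun j => if (j : ℕ) < m then x j else y j)

/-- The gradient of the finite part of an extended-real-valued function (used only at interior
points of its domain at which it is differentiable). -/
def grad (φ : Space n → EReal) (x : Space n) : Space n :=
  gradient (fun y => (φ y).toReal) x

/-- The partial gradient `∇_i φ(x)`. -/
def blockGrad (φ : Space n → EReal) (i : Fin N) (x : Space n) : EuclideanSpace ℝ (Fin (n i)) :=
  (grad φ x) i

/-- The partial Hessian `∇²_{ii} φ(x)`, as a continuous linear operator. -/
def blockHess (φ : Space n → EReal) (i : Fin N) (x : Space n) :
    EuclideanSpace ℝ (Fin (n i)) →L[ℝ] EuclideanSpace ℝ (Fin (n i)) :=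
  fderiv ℝ (fun z => blockGrad φ i (setBlock x i z)) (x i)

/-- The standing requirements on a (candidate) kernel: proper, lsc, domain with nonempty interior,
continuously differentiable on the interior of the domain. -/
structure IsKernelBase (h : Space n → EReal) : Prop where
  proper : IsProper h
  lsc : LowerSemicontinuous h
  interior_nonempty : (interior (dom h)).Nonempty
  contDiffOn : ContDiffOn ℝ 1 (fun y => (h y).toReal) (interior (dom h))

/-- `i`-th block convexity: each slice in the `i`-th block is a convex function. -/
def IsBlockConvex (i : Fin N) (h : Space n → EReal) : Prop :=
  ∀ x ∈ dom h, ConvexOn ℝ {z | setBlock x i z ∈ dom h} (fun z => (h (setBlock x i z)).toReal)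

/-- `i`-th block strict convexity. -/
def IsBlockStrictConvex (i : Fin N) (h : Space n → EReal) : Prop :=
  ∀ x ∈ dom h,
    StrictConvexOn ℝ {z | setBlock x i z ∈ dom h} (fun z => (h (setBlock x i z)).toReal)

/-- `i`-th block strong convexity with modulus `σ`. -/
def IsBlockStrongConvex (i : Fin N) (σ : ℝ) (h : Space n → EReal) : Prop :=
  ∀ x ∈ dom h,
    StrongConvexOn {z | setBlock x i z ∈ dom h} σ (fun z => (h (setBlock x i z)).toReal)

/-- `i`-th block kernel function: `i`-th block convex with 1-coercive slices. -/
structure IsBlockKernel (i : Fin N) (h : Space n → EReal) : Prop where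
  base : IsKernelBase h
  convex : IsBlockConvex i h
  coercive : ∀ x ∈ dom h,
    Tendsto (fun z : EuclideanSpace ℝ (Fin (n i)) => h (setBlock x i z) / ((‖z‖ : ℝ) : EReal))
      (Bornology.cobounded (EuclideanSpace ℝ (Fin (n i)))) (𝓝 ⊤)

/-- `i`-th block essential smoothness. -/
def IsBlockEssSmooth (i : Fin N) (h : Space n → EReal) : Prop :=
  ∀ (u : ℕ → Space n) (x : Space n), (∀ k, u k ∈ interior (dom h)) → x ∈ frontier (dom h) →
    Tendsto u atTop (𝓝 x) → Tendsto (fun k => ‖blockGrad h i (u k)‖) atTop atTop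

/-- `i`-th block Legendre functions. -/
structure IsBlockLegendre (i : Fin N) (h : Space n → EReal) : Prop where
  base : IsKernelBase h
  essSmooth : IsBlockEssSmooth i h
  strictConvex : IsBlockStrictConvex i h

/-- `f` is `(L_1, …, L_N)`-smooth relative to `(h_1, …, h_N)`. -/
structure IsRelSmooth (L : Fin N → ℝ) (h : Fin N → Space n → EReal) (f : Space n → EReal) :
    Prop where
  kernel : ∀ i, IsBlockKernel i (h i)
  proper : IsProper f
  lsc : LowerSemicontinuous f
  pos : ∀ i, 0 < L i
  convex : ∀ i, ∀ x ∈ interior (dom (h i)),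
    ConvexOn ℝ {z | setBlock x i z ∈ interior (dom (h i))}
      (fun z => L i * (h i (setBlock x i z)).toReal - (f (setBlock x i z)).toReal)

open Classical in
/-- The Bregman distance `D_h(y, x)`. -/
def bregman (h : Space n → EReal) (y x : Space n) : EReal :=
  if y ∈ dom h ∧ x ∈ interior (dom h) then
    (((h y).toReal - (h x).toReal - inner ℝ (grad h x) (y - x) : ℝ) : EReal)
  else ⊤

/-! ### The problem, the algorithm and the Lyapunov function -/

/-- The cost `Φ(x) = f(x) + ∑ g_i(x_i)`. -/
def cost (f : Space n → EReal) (g : ∀ i, EuclideanSpace ℝ (Fin (n i)) → EReal) (x : Space n) :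
    EReal :=
  f x + ∑ i, g i (x i)

/-- The basic requirements on the problem of minimizing `cost f g` over `closure C`. -/
structure BasicAssumption [NeZero N] (C : Set (Space n)) (f : Space n → EReal)
    (g : ∀ i, EuclideanSpace ℝ (Fin (n i)) → EReal) (h : Fin N → Space n → EReal)
    (L : Fin N → ℝ) : Prop where
  C_nonempty : C.Nonempty
  C_convex : Convex ℝ C
  C_open : IsOpen C
  g_proper : ∀ i, IsProper (g i)
  g_lsc : ∀ i, LowerSemicontinuous (g i)
  h_legendre : ∀ i, IsBlockLegendre i (h i)
  h_dom : ∀ i, interior (dom (h i)) = interior (dom (h 0))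
  C_subset : closure C ⊆ closure (dom (h 0))
  dom_g : ∃ x ∈ C, ∑ i, g i (x i) < ⊤
  f_finite : interior (dom (h 0)) ⊆ dom f
  f_contDiffOn : ContDiffOn ℝ 1 (fun y => (f y).toReal) (interior (dom (h 0)))
  f_relSmooth : IsRelSmooth L h f
  argmin_nonempty : ∃ x ∈ closure C, ∀ y ∈ closure C, cost f g x ≤ cost f g y

/-- The objective of the `i`-th block subproblem with step size `γ` and inertial parameter `α`:
`⟪∇_i f(x) - (α/γ)(x_i - y_i), z - x_i⟫ + (1/γ) D_{h_i}(x + U_i(z - x_i), x) + g_i(z)`. -/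
def model (f : Space n → EReal) (g : ∀ i, EuclideanSpace ℝ (Fin (n i)) → EReal)
    (h : Fin N → Space n → EReal) (i : Fin N) (γ α : ℝ) (x y : Space n)
    (z : EuclideanSpace ℝ (Fin (n i))) : EReal :=
  ((inner ℝ (blockGrad f i x - (α / γ) • (x i - y i)) (z - x i) : ℝ) : EReal)
    + ((1 / γ : ℝ) : EReal) * bregman (h i) (setBlock x i z) x + g i z

/-- The block inertial Bregman proximal mapping `T_i(x, y)`: the set of minimizers of the model
(with the usual convention that a function identically `+∞` has no minimizers). -/
def proxMap (f : Space n → EReal) (g : ∀ i, EuclideanSpace ℝ (Fin (n i)) → EReal)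
    (h : Fin N → Space n → EReal) (i : Fin N) (γ α : ℝ) (x y : Space n) :
    Set (EuclideanSpace ℝ (Fin (n i))) :=
  {z | model f g h i γ α x y z < ⊤ ∧ ∀ w, model f g h i γ α x y z ≤ model f g h i γ α x y w}

/-- Whenever a step size is in `(0, 1/L_i)`, replacing the `i`-th block by a point of the block
proximal mapping leads into `C`. -/
def ProxIntoC [NeZero N] (C : Set (Space n)) (f : Space n → EReal)
    (g : ∀ i, EuclideanSpace ℝ (Fin (n i)) → EReal) (h : Fin N → Space n → EReal)
    (L : Fin N → ℝ) (γ α : ℕ → Fin N → ℝ) : Prop :=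
  ∀ (k : ℕ) (i : Fin N), γ k i ∈ Ioo 0 (1 / L i) →
    ∀ x ∈ interior (dom (h 0)), ∀ y ∈ interior (dom (h 0)),
      ∀ z ∈ proxMap f g h i (γ k i) (α k i) x y, setBlock x i z ∈ C

/-- The previous iterate `x^{k-1}`, where `xm` stands for `x^{-1}`. -/
def prev (xm : Space n) (x : ℕ → Space n) : ℕ → Space n
  | 0 => xm
  | k + 1 => x k

/-- `x` is generated by BIBPA from `x^{-1} = xm` and `x^0` with step sizes `γ k i` and inertial
parameters `α k i`: `x_i^{k+1} ∈ T_i(x^{k,i-1}, x^{k-1})` for all `k` and `i`. -/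
structure IsBIBPASeq [NeZero N] (f : Space n → EReal)
    (g : ∀ i, EuclideanSpace ℝ (Fin (n i)) → EReal) (h : Fin N → Space n → EReal)
    (γ α : ℕ → Fin N → ℝ) (xm : Space n) (x : ℕ → Space n) : Prop where
  init : x 0 ∈ interior (dom (h 0))
  init_prev : xm ∈ interior (dom (h 0))
  step : ∀ (k : ℕ) (i : Fin N),
    x (k + 1) i ∈ proxMap f g h i (γ k i) (α k i) (mix i (x (k + 1)) (x k)) (prev xm x k)

/-- `a_i^k = (1 - γ_i^k L_i)/γ_i^k - |α_i^k|/(σ_i γ_i^k) - δ_i`. -/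
def aCoef (L σ δ : Fin N → ℝ) (γ α : ℕ → Fin N → ℝ) (k : ℕ) (i : Fin N) : ℝ :=
  (1 - γ k i * L i) / γ k i - |α k i| / (σ i * γ k i) - δ i

/-- `b_i^k = δ_i - |α_i^k|/(σ_i γ_i^k)`. -/
def bCoef (σ δ : Fin N → ℝ) (γ α : ℕ → Fin N → ℝ) (k : ℕ) (i : Fin N) : ℝ :=
  δ i - |α k i| / (σ i * γ k i)

/-- The rules for choosing the step sizes, the inertial parameters and the weights `δ`. -/
structure ParamRule (L σ δ : Fin N → ℝ) (γ α : ℕ → Fin N → ℝ) : Prop where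
  limits : ∃ αlim γlow : Fin N → ℝ, ∀ i,
    Tendsto (fun k => α k i) atTop (𝓝 (αlim i)) ∧
    0 < γlow i ∧ γlow i ≤ (σ i - 2 * |αlim i|) / (σ i * L i) ∧ ∀ k, γlow i ≤ γ k i
  alpha_lt : ∀ k i, |α k i| < σ i / 2
  gamma_le : ∀ k i, γ k i ≤ (σ i - 2 * |α k i|) / (σ i * L i)
  a_nonneg : ∀ k i, 0 ≤ aCoef L σ δ γ α k i
  b_nonneg : ∀ k i, 0 ≤ bCoef σ δ γ α k i
  /-- Nondegeneracy: `D_{h_i}(x^{k,i}, x^{k,i-1})` enters the telescoping sum of the Lyapunov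
  decrements with the total weight `a_i^k + b_i^{k+1}`. -/
  nondegenerate : ∃ ρ : ℝ, 0 < ρ ∧
    ∀ k i, ρ ≤ aCoef L σ δ γ α k i + bCoef σ δ γ α (k + 1) i

/-- The Lyapunov function
`𝓛(x, y) = Φ(x) + ∑ δ_i D_{h_i}((x_1,…,x_i,y_{i+1},…,y_N), (x_1,…,x_{i-1},y_i,…,y_N))`
on `ℝⁿ × ℝⁿ` with its Euclidean norm. -/
def lyapunov (f : Space n → EReal) (g : ∀ i, EuclideanSpace ℝ (Fin (n i)) → EReal)
    (h : Fin N → Space n → EReal) (δ : Fin N → ℝ) (p : WithLp 2 (Space n × Space n)) : EReal :=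
  cost f g p.fst + ∑ i : Fin N, (δ i : EReal) *
    bregman (h i) (mix ((i : ℕ) + 1) p.fst p.snd) (mix (i : ℕ) p.fst p.snd)

end BIBPA

end

/-! Write E_k for the value of the Lyapunov function at (x^{k+1}, x^k). The proof combines three
facts about the iterates with the Kurdyka–Łojasiewicz inequality.

Decrease. Testing the i-th subproblem with the old block and adding the descent inequality for f
gives `block_decrease`. Strong convexity turns the inertial inner product into Bregman distances,
and summing over blocks gives `energy_succ_le`. Only a_i^k + b_i^{k+1} is bounded away from zero, so
the square of a step is controlled by two consecutive decrements (`exists_energy_decrease`).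

Subgradient bound. Subgradients of the Lyapunov function are not computed by calculus rules. Near an
iterate the function is bounded below by its value minus κ times the distance, up to o(distance),
with κ proportional to the last two steps: optimality in the subproblems bounds the slopes of the
g_i, and Lipschitz block gradients bound those of f and of the Bregman terms. A proximal
regularization converts a lower slope κ into a limiting subgradient of norm at most 2κ
(`exists_mem_subdiff_norm_le`), which yields `exists_infEDist_le`.

Cluster points. Passing to the limit in the subproblems shows that at every cluster point xs the
values of g_i converge along the subsequence, E_k tends to Φ(xs), and 0 is a regular subgradient of
Φ at xs. Since the Lyapunov function dominates Φ(x) and equals it at (xs, xs), 0 is a subgradient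
there too, so the KŁ property applies at (xs, xs).

The KŁ argument `summable_of_kl` then gives finite length. The sequence is therefore Cauchy and
converges to its stationary cluster point. -/

open Filter Topology Set

noncomputable section

namespace BIBPA

/-! ### From lower slopes to limiting subgradients -/

section Slope

variable {F : Type*} [NormedAddCommGroup F] [InnerProductSpace ℝ F]

theorem coe_sub_le_of_coe_le_add {a b : ℝ} {u : EReal} (h : (a : EReal) ≤ u + (b : EReal)) :
    ((a - b : ℝ) : EReal) ≤ u := by
  induction u with
  | bot => simp at h
  | top => exact le_top
  | coe u =>
    norm_cast at h ⊢
    linarith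

theorem add_coe_le_coe {a b : ℝ} {u : EReal} (h : u + (b : EReal) ≤ (a : EReal)) :
    u ≤ ((a - b : ℝ) : EReal) := by
  induction u with
  | bot => exact bot_le
  | top => simp at h
  | coe u =>
    norm_cast at h ⊢
    linarith

/-- A minimizer of `φ + (c / 2) ‖· - p‖²` over a ball around `p` that lies in the interior of the
ball has `c • (p - z)` as a regular subgradient. -/
theorem mem_regularSubdiff_of_prox {φ : F → EReal} {p z : F} {b c r : ℝ} (hc : 0 < c)
    (hz : φ z = b) (hzr : ‖z - p‖ < r)
    (hmin : ∀ y ∈ Metric.closedBall p r,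
      ((b + c / 2 * ‖z - p‖ ^ 2 : ℝ) : EReal) ≤ φ y + ((c / 2 * ‖y - p‖ ^ 2 : ℝ) : EReal)) :
    c • (p - z) ∈ regularSubdiff φ z := by
  refine ⟨by simp [hz], by simp [hz], fun ε hε => ?_⟩
  have h1 : ∀ᶠ y in 𝓝 z, y ∈ Metric.ball p r :=
    Metric.isOpen_ball.mem_nhds (by simpa [dist_eq_norm] using hzr)
  -- Expanding the square leaves the remainder (c/2)‖y - z‖², which is at most ε‖y - z‖ on this
  -- ball.
  have h2 : ∀ᶠ y in 𝓝 z, y ∈ Metric.ball z (2 * ε / c) :=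
    Metric.isOpen_ball.mem_nhds (Metric.mem_ball_self (by positivity))
  filter_upwards [h1, h2] with y hy1 hy2
  refine le_trans ?_ (coe_sub_le_of_coe_le_add (hmin y (Metric.ball_subset_closedBall hy1)))
  rw [hz, EReal.toReal_coe, EReal.coe_le_coe_iff]
  have hy3 : ‖y - z‖ < 2 * ε / c := by simpa [dist_eq_norm] using hy2
  rw [lt_div_iff₀ hc] at hy3
  have e : ‖y - p‖ ^ 2 = ‖y - z‖ ^ 2 + 2 * inner ℝ (y - z) (z - p) + ‖z - p‖ ^ 2 := by
    rw [← norm_add_sq_real]; congr 2; abel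
  have e2 : inner ℝ (c • (p - z)) (y - z) = - c * inner ℝ (y - z) (z - p) := by
    rw [real_inner_smul_left, real_inner_comm, ← neg_sub z p, inner_neg_right]; ring
  rw [e, e2]
  nlinarith [norm_nonneg (y - z)]

/-- If the lower slope of an lsc function at `p` is at most `κ`, then it has a limiting subgradient
at `p` of norm at most `2 κ`. -/
theorem exists_mem_subdiff_norm_le [ProperSpace F] {φ : F → EReal} {p : F} {a κ r : ℝ}
    (hr : 0 < r) (hκ : 0 ≤ κ) (hp : φ p = a)
    (hlsc : LowerSemicontinuousOn φ (Metric.closedBall p r))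
    (hslope : ∀ z ∈ Metric.closedBall p r, ((a - κ * ‖z - p‖ : ℝ) : EReal) ≤ φ z) :
    ∃ w ∈ subdiff φ p, ‖w‖ ≤ 2 * κ := by
  -- The growing part of the penalty forces the minimizers to p; the summand 2κ/r keeps each of them
  -- strictly inside the ball of radius r.
  set c : ℕ → ℝ := fun k => k + 1 + 2 * κ / r with hc
  have hc0 : ∀ k, 0 < c k := fun k => by positivity
  have hcr : ∀ k, 2 * κ < c k * r := fun k => by
    have : 2 * κ / r * r = 2 * κ := by field_simp
    simp only [hc]; nlinarith [Nat.cast_nonneg (α := ℝ) k]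
  have hpB : p ∈ Metric.closedBall p r := Metric.mem_closedBall_self hr.le
  have key : ∀ k, ∃ z ∈ Metric.closedBall p r, ∀ y ∈ Metric.closedBall p r,
      φ z + ((c k / 2 * ‖z - p‖ ^ 2 : ℝ) : EReal) ≤
        φ y + ((c k / 2 * ‖y - p‖ ^ 2 : ℝ) : EReal) := by
    intro k
    have hl : LowerSemicontinuousOn (fun z => φ z + ((c k / 2 * ‖z - p‖ ^ 2 : ℝ) : EReal))
        (Metric.closedBall p r) := by
      refine hlsc.add' (g := fun z => ((c k / 2 * ‖z - p‖ ^ 2 : ℝ) : EReal)) ?_ ?_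
      · apply Continuous.lowerSemicontinuous _ |>.lowerSemicontinuousOn
        exact continuous_coe_real_ereal.comp (by fun_prop)
      · intro z _
        exact EReal.continuousAt_add (Or.inr (EReal.coe_ne_bot _)) (Or.inr (EReal.coe_ne_top _))
    obtain ⟨z, hz, hzm⟩ := hl.exists_isMinOn ⟨p, hpB⟩ (isCompact_closedBall p r)
    exact ⟨z, hz, fun y hy => hzm hy⟩
  choose z hzB hzmin using key
  have hup : ∀ k, φ (z k) ≤ ((a - c k / 2 * ‖z k - p‖ ^ 2 : ℝ) : EReal) := fun k => by
    have := hzmin k p hpB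
    rw [hp] at this
    refine add_coe_le_coe (this.trans_eq ?_)
    simp
  have hfin : ∀ k, ∃ b : ℝ, φ (z k) = b := fun k => by
    have h1 := hup k
    have h2 := hslope _ (hzB k)
    induction hφ : φ (z k) with
    | bot => rw [hφ] at h2; exact absurd (le_bot_iff.1 h2) (EReal.coe_ne_bot _)
    | top => rw [hφ] at h1; exact absurd (top_le_iff.1 h1) (EReal.coe_ne_top _)
    | coe b => exact ⟨b, rfl⟩
  choose b hb using hfin
  have hb1 : ∀ k, b k ≤ a - c k / 2 * ‖z k - p‖ ^ 2 := fun k => by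
    have := hup k; rw [hb k] at this; exact_mod_cast this
  have hb2 : ∀ k, a - κ * ‖z k - p‖ ≤ b k := fun k => by
    have := hslope _ (hzB k); rw [hb k] at this; exact_mod_cast this
  -- Comparison with p bounds the penalty by a - φ(z), and the slope bounds a - φ(z) by κ‖z - p‖.
  -- This is the source of the factor 2.
  have ht : ∀ k, c k * ‖z k - p‖ ≤ 2 * κ := fun k => by
    rcases (norm_nonneg (z k - p)).eq_or_lt with h | h
    · rw [← h]; simpa using hκ
    · have : (c k * ‖z k - p‖) * ‖z k - p‖ ≤ (2 * κ) * ‖z k - p‖ := by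
        nlinarith [hb1 k, hb2 k]
      exact le_of_mul_le_mul_right this h
  have hnorm : ∀ k, ‖c k • (p - z k)‖ ≤ 2 * κ := fun k => by
    rw [norm_smul, norm_sub_rev, Real.norm_of_nonneg (hc0 k).le]; exact ht k
  have hreg : ∀ k, c k • (p - z k) ∈ regularSubdiff φ (z k) := fun k => by
    refine mem_regularSubdiff_of_prox (r := r) (hc0 k) (hb k) ?_ ?_
    · exact lt_of_mul_lt_mul_left ((ht k).trans_lt (hcr k)) (hc0 k).le
    · intro y hy
      have := hzmin k y hy
      rwa [hb k, ← EReal.coe_add] at this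
  have hct : Tendsto c atTop atTop :=
    tendsto_atTop_add_const_right _ _ (tendsto_atTop_add_const_right _ _
      tendsto_natCast_atTop_atTop)
  have hdist : Tendsto (fun k => ‖z k - p‖) atTop (𝓝 0) := by
    refine squeeze_zero (fun k => norm_nonneg _) (fun k => ?_)
      (Tendsto.div_atTop (tendsto_const_nhds (x := 2 * κ)) hct)
    rw [le_div_iff₀ (hc0 k), mul_comm]; exact ht k
  have hzp : Tendsto z atTop (𝓝 p) := tendsto_iff_norm_sub_tendsto_zero.2 hdist
  have hbt : Tendsto b atTop (𝓝 a) := by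
    refine tendsto_of_tendsto_of_tendsto_of_le_of_le (g := fun k => a - κ * ‖z k - p‖)
      (h := fun _ => a) ?_ tendsto_const_nhds hb2 (fun k => (hb1 k).trans ?_)
    · simpa using (tendsto_const_nhds (x := a)).sub (hdist.const_mul κ)
    · have := hc0 k
      have : 0 ≤ c k / 2 * ‖z k - p‖ ^ 2 := by positivity
      linarith
  obtain ⟨w, hw, s, hs, hsw⟩ := tendsto_subseq_of_bounded
    (Metric.isBounded_closedBall (x := (0 : F)) (r := 2 * κ))
    (x := fun k => c k • (p - z k)) (fun k => by simpa using hnorm k)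
  refine ⟨w, ⟨by simp [hp], by simp [hp], fun k => z (s k), fun k => c (s k) • (p - z (s k)),
    hzp.comp hs.tendsto_atTop, ?_, fun k => hreg _, hsw⟩, ?_⟩
  · have : Tendsto (fun k => ((b (s k) : ℝ) : EReal)) atTop (𝓝 (a : EReal)) :=
      (continuous_coe_real_ereal.tendsto a).comp (hbt.comp hs.tendsto_atTop)
    simpa only [hb, hp] using this
  · exact le_of_tendsto hsw.norm (Eventually.of_forall fun k => hnorm _)

theorem regularSubdiff_subset_subdiff {φ : F → EReal} {p : F} :
    regularSubdiff φ p ⊆ subdiff φ p := fun v hv =>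
  ⟨hv.1, hv.2.1, fun _ => p, fun _ => v, tendsto_const_nhds, tendsto_const_nhds, fun _ => hv,
    tendsto_const_nhds⟩

/-- For each ε the slope κ + ε holds on a small enough ball, where the previous theorem applies.
Bounding the distance to the subdifferential lets ε tend to 0 without a limit of subgradients. -/
theorem infEDist_subdiff_le [ProperSpace F] {φ : F → EReal} {p : F} {a κ r : ℝ}
    (hr : 0 < r) (hκ : 0 ≤ κ) (hp : φ p = a)
    (hlsc : LowerSemicontinuousOn φ (Metric.closedBall p r))
    (hslope : ∀ ε : ℝ, 0 < ε → ∀ᶠ z in 𝓝 p, ((a - (κ + ε) * ‖z - p‖ : ℝ) : EReal) ≤ φ z) :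
    Metric.infEDist (0 : F) (subdiff φ p) ≤ ENNReal.ofReal (2 * κ) := by
  have h1 : ∀ ε : ℝ, 0 < ε →
      Metric.infEDist (0 : F) (subdiff φ p) ≤ ENNReal.ofReal (2 * (κ + ε)) := by
    intro ε hε
    obtain ⟨s, hs, hsb⟩ := Metric.eventually_nhds_iff_ball.1 (hslope ε hε)
    have hm : 0 < min r (s / 2) := by positivity
    have hsub : Metric.closedBall p (min r (s / 2)) ⊆ Metric.ball p s :=
      Metric.closedBall_subset_ball ((min_le_right _ _).trans_lt (by linarith))
    obtain ⟨w, hw, hwn⟩ := exists_mem_subdiff_norm_le hm (by positivity : 0 ≤ κ + ε) hp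
      (hlsc.mono (Metric.closedBall_subset_closedBall (min_le_left _ _)))
      (fun z hz => hsb z (hsub hz))
    refine (Metric.infEDist_le_edist_of_mem hw).trans ?_
    rw [edist_dist, dist_zero_left]
    exact ENNReal.ofReal_le_ofReal hwn
  have h2 : Tendsto (fun ε : ℝ => ENNReal.ofReal (2 * (κ + ε))) (𝓝[>] 0)
      (𝓝 (ENNReal.ofReal (2 * κ))) := by
    have : Continuous fun ε : ℝ => ENNReal.ofReal (2 * (κ + ε)) :=
      ENNReal.continuous_ofReal.comp (by fun_prop)
    have h := this.tendsto 0
    simp only [add_zero] at h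
    exact h.mono_left nhdsWithin_le_nhds
  exact ge_of_tendsto h2 (eventually_nhdsWithin_of_forall fun ε hε => h1 ε hε)

end Slope

/-! ### First-order inequalities for convex functions -/

section Convex

variable {F : Type*} [NormedAddCommGroup F] [InnerProductSpace ℝ F]

/-- The difference quotients along the segment from a to b are at most φ b - φ a. Differentiability
is needed only at a, and S need not be open. -/
theorem convexOn_gradient_ineq {S : Set F} {φ : F → ℝ} {φ' : F →L[ℝ] ℝ} {a b : F}
    (h : ConvexOn ℝ S φ) (ha : a ∈ S) (hb : b ∈ S) (hd : HasFDerivAt φ φ' a) :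
    φ a + φ' (b - a) ≤ φ b := by
  have hl : HasDerivAt (fun t : ℝ => φ (a + t • (b - a))) (φ' (b - a)) 0 := by
    have h1 : HasDerivAt (fun t : ℝ => a + t • (b - a)) (b - a) 0 := by
      simpa using ((hasDerivAt_id (0 : ℝ)).smul_const (b - a)).const_add a
    have h2 : HasFDerivAt φ φ' (a + (0 : ℝ) • (b - a)) := by simpa using hd
    exact h2.comp_hasDerivAt 0 h1
  have hs := hl.hasDerivWithinAt (s := Ioi 0)
  rw [hasDerivWithinAt_iff_tendsto_slope' (by simp)] at hs
  have hle : φ' (b - a) ≤ φ b - φ a := by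
    refine le_of_tendsto hs ?_
    have : Ioo (0 : ℝ) 1 ∈ 𝓝[>] (0 : ℝ) := Ioo_mem_nhdsGT one_pos
    filter_upwards [this] with t ht
    have hc := h.2 ha hb (by linarith [ht.2] : 0 ≤ 1 - t) ht.1.le (by ring)
    have e : (1 - t) • a + t • b = a + t • (b - a) := by
      rw [sub_smul, one_smul, smul_sub]; abel
    rw [e] at hc
    simp only [slope_def_field, zero_smul, add_zero, sub_zero]
    rw [div_le_iff₀ ht.1]
    simp only [smul_eq_mul] at hc
    nlinarith
  linarith

theorem strongConvexOn_gradient_ineq {S : Set F} {φ : F → ℝ} {φ' : F →L[ℝ] ℝ} {a b : F} {m : ℝ}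
    (h : StrongConvexOn S m φ) (ha : a ∈ S) (hb : b ∈ S) (hd : HasFDerivAt φ φ' a) :
    φ a + φ' (b - a) + m / 2 * ‖b - a‖ ^ 2 ≤ φ b := by
  rw [strongConvexOn_iff_convex] at h
  have hn : HasFDerivAt (fun x : F => m / 2 * ‖x‖ ^ 2) ((m / 2) • (2 • (innerSL ℝ a))) a :=
    ((hasStrictFDerivAt_norm_sq a).hasFDerivAt).const_mul (m / 2)
  have := convexOn_gradient_ineq h ha hb (hd.sub hn)
  have e : ‖b - a‖ ^ 2 = ‖b‖ ^ 2 - 2 * inner ℝ a b + ‖a‖ ^ 2 := by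
    rw [norm_sub_sq_real, real_inner_comm]
  simp [inner_sub_right] at this
  rw [e, map_sub]
  linarith

end Convex

/-! ### The Kurdyka–Łojasiewicz argument for sequences -/

section KL

/-- A recursion `d (k+2) ≤ (d (k+1) + d k) / 4 + A (t (k+1) - t (k+3))` bounds the partial sums. -/
theorem sum_le_of_kl_recursion {d t : ℕ → ℝ} {A : ℝ} {m : ℕ} (hd : ∀ k, 0 ≤ d k)
    (hA : 0 ≤ A) (ht : ∀ k, m ≤ k → 0 ≤ t k) (q : ℕ)
    (hrec : ∀ j < q, d (m + j + 2) ≤ (d (m + j + 1) + d (m + j)) / 4 +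
      A * (t (m + j + 1) - t (m + j + 3))) :
    ∑ j ∈ Finset.range q, d (m + j + 2) ≤ d (m + 1) + d m + 2 * A * (t (m + 1) + t (m + 2)) := by
  -- The left side is a potential: advancing q by one changes it by twice the defect of the
  -- recursion, so it does not increase.
  have key : ∑ j ∈ Finset.range q, d (m + j + 2) + d (m + q + 1) + d (m + q) / 2
        + 2 * A * (t (m + q + 1) + t (m + q + 2)) ≤
      d (m + 1) + d m / 2 + 2 * A * (t (m + 1) + t (m + 2)) := by
    induction q with
    | zero => simp
    | succ q ih =>
      have h1 := ih fun j hj => hrec j (by omega)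
      have h2 := hrec q (by omega)
      rw [Finset.sum_range_succ]
      have e1 : m + (q + 1) + 1 = m + q + 2 := by ring
      have e2 : m + (q + 1) = m + q + 1 := by ring
      have e3 : m + (q + 1) + 2 = m + q + 3 := by ring
      rw [e1, e3, e2]
      linarith
  have h1 := ht (m + q + 1) (by omega)
  have h2 := ht (m + q + 2) (by omega)
  have h3 : 0 ≤ 2 * A * (t (m + q + 1) + t (m + q + 2)) := by positivity
  linarith [hd (m + q + 1), hd (m + q), hd m]

theorem concaveOn_tangent_le {η : ℝ} {ψ : ℝ → ℝ} (hψ : ConcaveOn ℝ (Icc 0 η) ψ)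
    (hdiff : ∀ s ∈ Ioo 0 η, DifferentiableAt ℝ ψ s) {s t : ℝ} (hs : s ∈ Icc 0 η)
    (ht : t ∈ Ioo 0 η) : deriv ψ t * (t - s) ≤ ψ t - ψ s := by
  have h := convexOn_gradient_ineq hψ.neg (Ioo_subset_Icc_self ht) hs
    (hdiff t ht).hasDerivAt.hasFDerivAt.neg
  simp at h
  linarith

/-- Monotonicity of the desingularizing function is not assumed. A concave function with positive
derivative at t₀ is increasing to the left of t₀: the tangent gives ψ t < ψ t₀, so of the two
alternatives in min (ψ s) (ψ t₀) ≤ ψ t only the first remains. -/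
theorem le_of_concaveOn_of_deriv_pos {η : ℝ} {ψ : ℝ → ℝ} (hψ : ConcaveOn ℝ (Icc 0 η) ψ)
    (hdiff : ∀ s ∈ Ioo 0 η, DifferentiableAt ℝ ψ s) {s t t₀ : ℝ} (hs : 0 < s)
    (hst : s ≤ t) (htt : t ≤ t₀) (ht₀ : t₀ < η) (hpos : 0 < deriv ψ t₀) : ψ s ≤ ψ t := by
  rcases htt.eq_or_lt with rfl | hlt
  · have := concaveOn_tangent_le hψ hdiff (s := s) (t := t) ⟨hs.le, by linarith⟩
      ⟨by linarith, ht₀⟩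
    nlinarith
  · have h1 := concaveOn_tangent_le hψ hdiff (s := t) (t := t₀) ⟨by linarith, by linarith⟩
      ⟨by linarith, ht₀⟩
    have h2 : ψ t < ψ t₀ := by nlinarith
    have h3 := hψ.min_le_of_mem_Icc (x := s) (y := t₀) (z := t) ⟨hs.le, by linarith⟩
      ⟨by linarith, ht₀.le⟩ ⟨hst, htt⟩
    rcases min_le_iff.1 h3 with h | h
    · exact h
    · linarith

/-- One step of the KŁ argument: decrease plus the KŁ inequality control the step length. -/
theorem kl_step {c M D S ψ' Δ δ : ℝ} (hc : 0 < c) (hM : 0 ≤ M) (hS : 0 ≤ S)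
    (hdec : c * D ^ 2 ≤ δ) (hconc : ψ' * δ ≤ Δ) (hkl : 1 ≤ ψ' * (M * S)) :
    D ≤ S / 4 + M / c * Δ := by
  have hMS : 0 ≤ M * S := by positivity
  -- The sign of the derivative comes from the KŁ inequality itself, since the other factor is
  -- nonnegative.
  have hψ : 0 < ψ' := by
    by_contra h
    push Not at h
    nlinarith
  have hδ : 0 ≤ δ := le_trans (by positivity) hdec
  have hΔ : 0 ≤ Δ := le_trans (by positivity) hconc
  have h1 : c * D ^ 2 ≤ M * S * Δ := by
    have h2 : δ ≤ ψ' * (M * S) * δ := by nlinarith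
    have h3 : (M * S) * (ψ' * δ) ≤ M * S * Δ := mul_le_mul_of_nonneg_left hconc hMS
    nlinarith
  have h2 : D ^ 2 ≤ S * (M / c * Δ) := by
    have : S * (M / c * Δ) = M * S * Δ / c := by field_simp
    rw [this, le_div_iff₀ hc]; linarith
  have h3 : 0 ≤ M / c * Δ := by positivity
  -- With T = (M / c) Δ, the arithmetic-geometric mean inequality in the form S T ≤ (S/4 + T)² gives
  -- the weight 1/4 needed for summation.
  refine abs_le_of_sq_le_sq' (a := D) ?_ (by positivity) |>.2
  nlinarith [sq_nonneg (S / 4 - M / c * Δ)]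

/-- The KŁ inequality is available only near `xs`, which is reached only along a subsequence. The
recursion bounds the length of the remaining path by quantities that vanish along the subsequence.
Started close enough, the sequence cannot leave the ball, so the recursion holds from then on. -/
theorem summable_of_kl {X : Type*} [NormedAddCommGroup X] {x : ℕ → X} {xs : X} {E : ℕ → ℝ}
    {Es c M η ε : ℝ} {ψ : ℝ → ℝ} (hc : 0 < c) (hM : 0 ≤ M) (hη : 0 < η) (hε : 0 < ε)
    (hψ : ConcaveOn ℝ (Icc 0 η) ψ) (hψ0 : ∀ s ∈ Icc 0 η, 0 ≤ ψ s)
    (hdiff : ∀ s ∈ Ioo 0 η, DifferentiableAt ℝ ψ s)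
    (hanti : Antitone E) (hlim : Tendsto E atTop (𝓝 Es)) (hgt : ∀ k, Es < E k)
    (hdec : ∀ k, c * ‖x (k + 2) - x (k + 1)‖ ^ 2 ≤ E k - E (k + 2))
    (hd0 : Tendsto (fun k => ‖x (k + 1) - x k‖) atTop (𝓝 0))
    {s : ℕ → ℕ} (hs : Tendsto s atTop atTop) (hxs : Tendsto (x ∘ s) atTop (𝓝 xs))
    (hKL : ∀ k, ‖x (k + 2) - xs‖ < ε → ‖x (k + 1) - xs‖ < ε → E (k + 1) < Es + η →
      1 ≤ deriv ψ (E (k + 1) - Es) * (M * (‖x (k + 2) - x (k + 1)‖ + ‖x (k + 1) - x k‖))) :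
    Summable (fun k => ‖x (k + 1) - x k‖) := by
  set d : ℕ → ℝ := fun k => ‖x (k + 1) - x k‖ with hd
  have hdnn : ∀ k, 0 ≤ d k := fun k => norm_nonneg _
  have hsa : ∀ i, Tendsto (fun j => s j + i) atTop atTop := fun i =>
    (tendsto_add_atTop_nat i).comp hs
  have hx0 : Tendsto (fun j => ‖x (s j) - xs‖) atTop (𝓝 0) :=
    tendsto_iff_norm_sub_tendsto_zero.1 hxs
  have hds : ∀ i, Tendsto (fun j => d (s j + i)) atTop (𝓝 0) := fun i =>
    hd0.comp (hsa i)
  have hx1 : Tendsto (fun j => ‖x (s j + 1) - xs‖) atTop (𝓝 0) := by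
    refine squeeze_zero (fun _ => norm_nonneg _) (fun j => ?_) (by simpa using (hds 0).add hx0)
    exact norm_sub_le_norm_sub_add_norm_sub _ _ _
  have hx2 : Tendsto (fun j => ‖x (s j + 2) - xs‖) atTop (𝓝 0) := by
    refine squeeze_zero (fun _ => norm_nonneg _) (fun j => ?_) (by simpa using (hds 1).add hx1)
    exact norm_sub_le_norm_sub_add_norm_sub _ _ _
  have hEη : ∀ᶠ k in atTop, E k < Es + η := hlim.eventually (gt_mem_nhds (by linarith))
  have hIoo : ∀ k, E k < Es + η → E k - Es ∈ Ioo 0 η := fun k hk =>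
    ⟨by linarith [hgt k], by linarith⟩
  -- a point at which the derivative of `ψ` is positive
  obtain ⟨k₀, hk1, hk2, hk3⟩ : ∃ k₀, ‖x (k₀ + 2) - xs‖ < ε ∧ ‖x (k₀ + 1) - xs‖ < ε ∧
      E (k₀ + 1) < Es + η := by
    have := ((hx2.eventually (gt_mem_nhds hε)).and (hx1.eventually (gt_mem_nhds hε))).and
      ((hsa 1).eventually hEη)
    obtain ⟨j, hj⟩ := this.exists
    exact ⟨s j, hj.1.1, hj.1.2, hj.2⟩
  have hpos : 0 < deriv ψ (E (k₀ + 1) - Es) := by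
    have h := hKL k₀ hk1 hk2 hk3
    by_contra hneg
    push Not at hneg
    have : 0 ≤ M * (‖x (k₀ + 2) - x (k₀ + 1)‖ + ‖x (k₀ + 1) - x k₀‖) := by positivity
    nlinarith
  set K := k₀ + 1 with hK
  have hEK : ∀ k, K ≤ k → E k < Es + η := fun k hk => (hanti hk).trans_lt hk3
  have hψanti : Antitone fun j => ψ (E (K + j) - Es) := by
    intro i j hij
    refine le_of_concaveOn_of_deriv_pos hψ hdiff (t₀ := E K - Es) ?_ ?_ ?_ (hIoo _ hk3).2 hpos
    · linarith [hgt (K + j)]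
    · linarith [hanti (by omega : K + i ≤ K + j)]
    · linarith [hanti (by omega : K ≤ K + i)]
  have hbdd : BddBelow (range fun j => ψ (E (K + j) - Es)) := by
    refine ⟨0, ?_⟩
    rintro _ ⟨j, rfl⟩
    exact hψ0 _ (Ioo_subset_Icc_self (hIoo _ (hEK _ (by omega))))
  -- Continuity of ψ at 0 is not assumed, so the values ψ (E k - Es) may tend to a positive number.
  -- Only differences enter the recursion, and subtracting the limit makes t tend to 0.
  set l := ⨅ j, ψ (E (K + j) - Es) with hl
  have hψlim := tendsto_atTop_ciInf hψanti hbdd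
  rw [← hl] at hψlim
  set t : ℕ → ℝ := fun k => ψ (E k - Es) - l with ht
  have htnn : ∀ k, K ≤ k → 0 ≤ t k := fun k hk => by
    obtain ⟨j, rfl⟩ := Nat.exists_eq_add_of_le hk
    exact sub_nonneg.2 (ciInf_le hbdd j)
  have htlim : Tendsto t atTop (𝓝 0) := by
    rw [← tendsto_add_atTop_iff_nat K]
    have := hψlim.sub_const l
    rw [sub_self] at this
    refine this.congr fun j => ?_
    simp only [ht, add_comm]
  have hrec : ∀ k, K ≤ k → ‖x (k + 2) - xs‖ < ε → ‖x (k + 1) - xs‖ < ε →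
      d (k + 2) ≤ (d (k + 1) + d k) / 4 + M / c * (t (k + 1) - t (k + 3)) := by
    intro k hk h2 h1
    have hkη := hEK (k + 1) (by omega)
    -- The decrease from index k + 1 to k + 3 controls the new step d (k + 2), while the subgradient
    -- bound at k + 1 involves the two preceding steps.
    refine kl_step hc hM (add_nonneg (hdnn _) (hdnn _)) (hdec (k + 1)) ?_ (hKL k h2 h1 hkη)
    have := concaveOn_tangent_le hψ hdiff
      (Ioo_subset_Icc_self (hIoo (k + 3) (hEK _ (by omega)))) (hIoo _ hkη)
    simp only [ht]
    have e : E (k + 1) - Es - (E (k + 3) - Es) = E (k + 1) - E (k + 1 + 2) := by ring_nf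
    rw [e] at this
    linarith
  have hBlim : Tendsto (fun j => ‖x (s j + 2) - xs‖ + (d (s j + 1) + d (s j + 0) +
      2 * (M / c) * (t (s j + 1) + t (s j + 2)))) atTop (𝓝 0) := by
    have h1 := htlim.comp (hsa 1)
    have h2 := htlim.comp (hsa 2)
    have := hx2.add (((hds 1).add (hds 0)).add ((h1.add h2).const_mul (2 * (M / c))))
    simpa only [Function.comp_def, add_zero, mul_zero] using this
  -- The distance of x (m + 2) from `xs` plus the bound on the whole remaining length is below ε.
  obtain ⟨m, hmK, hm1, hmB⟩ : ∃ m, K ≤ m ∧ ‖x (m + 1) - xs‖ < ε ∧ ‖x (m + 2) - xs‖ +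
      (d (m + 1) + d m + 2 * (M / c) * (t (m + 1) + t (m + 2))) < ε := by
    obtain ⟨j, hj⟩ := ((hs.eventually_ge_atTop K).and ((hx1.eventually (gt_mem_nhds hε)).and
      (hBlim.eventually (gt_mem_nhds hε)))).exists
    exact ⟨s j, hj.1, hj.2.1, hj.2.2⟩
  have hA : 0 ≤ M / c := by positivity
  have hsum : ∀ q, (∀ j < q, ‖x (m + j + 2) - xs‖ < ε ∧ ‖x (m + j + 1) - xs‖ < ε) →
      ∑ j ∈ Finset.range q, d (m + j + 2) ≤
        d (m + 1) + d m + 2 * (M / c) * (t (m + 1) + t (m + 2)) := fun q hq =>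
    sum_le_of_kl_recursion hdnn hA (fun k hk => htnn k (hmK.trans hk)) q fun j hj =>
      hrec (m + j) (by omega) (hq j hj).1 (hq j hj).2
  -- The length bound up to j needs only earlier points to be in the ball, and it places the next
  -- point there.
  have hstay : ∀ q, ∀ j < q, ‖x (m + j + 2) - xs‖ < ε ∧ ‖x (m + j + 1) - xs‖ < ε := by
    intro q
    induction q with
    | zero => intro j hj; omega
    | succ q ih =>
      intro j hj
      rcases Nat.lt_succ_iff_lt_or_eq.1 hj with h | rfl
      · exact ih j h
      refine ⟨?_, ?_⟩
      · have h1 := hsum j ih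
        have h2 := dist_le_range_sum_dist (fun i => x (m + 2 + i)) j
        have h3 : ∑ i ∈ Finset.range j, dist (x (m + 2 + i)) (x (m + 2 + (i + 1))) =
            ∑ i ∈ Finset.range j, d (m + i + 2) := by
          refine Finset.sum_congr rfl fun i _ => ?_
          rw [dist_comm, dist_eq_norm]
          simp only [hd]
          congr 3
          · ring
          · ring
        rw [h3, dist_comm, dist_eq_norm] at h2
        have h4 := norm_sub_le_norm_sub_add_norm_sub (x (m + j + 2)) (x (m + 2)) xs
        have e : m + 2 + j = m + j + 2 := by ring
        simp only [e, add_zero] at h2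
        linarith
      · rcases j with _ | j
        · simpa using hm1
        · have := (ih j (by omega)).1
          have e : m + (j + 1) + 1 = m + j + 2 := by ring
          rwa [e]
  have : Summable fun j => d (j + (m + 2)) := by
    refine summable_of_sum_range_le (fun _ => hdnn _)
      (c := d (m + 1) + d m + 2 * (M / c) * (t (m + 1) + t (m + 2))) fun q => ?_
    refine le_of_eq_of_le (Finset.sum_congr rfl fun j _ => ?_) (hsum q (hstay q))
    congr 1; ring
  exact (summable_nat_add_iff (m + 2)).1 this

end KL

/-! ### Block replacement and partially updated points -/

section Blocks

variable {N : ℕ} {n : Fin N → ℕ}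

/-- The embedding `U_i` of the `i`-th block. -/
def blockIncl (i : Fin N) : EuclideanSpace ℝ (Fin (n i)) →L[ℝ] Space n :=
  (PiLp.continuousLinearEquiv 2 ℝ (fun i : Fin N => EuclideanSpace ℝ (Fin (n i)))).symm.toContinuousLinearMap ∘L
    ContinuousLinearMap.single ℝ (fun i : Fin N => EuclideanSpace ℝ (Fin (n i))) i

theorem blockIncl_apply (i j : Fin N) (w : EuclideanSpace ℝ (Fin (n i))) :
    blockIncl i w j = Pi.single (M := fun i : Fin N => EuclideanSpace ℝ (Fin (n i))) i w j := rfl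

@[simp] theorem blockIncl_apply_self (i : Fin N) (w : EuclideanSpace ℝ (Fin (n i))) :
    blockIncl i w i = w := by simp [blockIncl_apply]

theorem blockIncl_apply_ne {i j : Fin N} (h : j ≠ i) (w : EuclideanSpace ℝ (Fin (n i))) :
    blockIncl i w j = 0 := by simp [blockIncl_apply, h]

theorem inner_blockIncl (v : Space n) (i : Fin N) (w : EuclideanSpace ℝ (Fin (n i))) :
    inner ℝ v (blockIncl i w) = inner ℝ (v i) w := by
  rw [PiLp.inner_apply, Finset.sum_eq_single i]
  · simp
  · intro j _ hj
    rw [blockIncl_apply_ne hj, inner_zero_right]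
  · simp

theorem norm_blockIncl (i : Fin N) (w : EuclideanSpace ℝ (Fin (n i))) :
    ‖(blockIncl i w : Space n)‖ = ‖w‖ := by
  rw [← sq_eq_sq₀ (norm_nonneg _) (norm_nonneg _), ← real_inner_self_eq_norm_sq,
    ← real_inner_self_eq_norm_sq, inner_blockIncl, blockIncl_apply_self]

theorem setBlock_eq_add (x : Space n) (i : Fin N) (z : EuclideanSpace ℝ (Fin (n i))) :
    setBlock x i z = x + blockIncl i (z - x i) := by
  ext j : 1
  by_cases h : j = i
  · subst h; simp [setBlock]
  · simp [setBlock, h, blockIncl_apply_ne h]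

@[simp] theorem setBlock_apply_self (x : Space n) (i : Fin N) (z : EuclideanSpace ℝ (Fin (n i))) :
    setBlock x i z i = z := by simp [setBlock]

@[simp] theorem setBlock_self (x : Space n) (i : Fin N) : setBlock x i (x i) = x := by
  simp [setBlock_eq_add]

@[simp] theorem setBlock_setBlock (x : Space n) (i : Fin N)
    (z w : EuclideanSpace ℝ (Fin (n i))) : setBlock (setBlock x i z) i w = setBlock x i w := by
  simp [setBlock]

theorem continuous_setBlock (i : Fin N) :
    Continuous fun p : Space n × EuclideanSpace ℝ (Fin (n i)) => setBlock p.1 i p.2 := by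
  simp only [setBlock_eq_add]
  fun_prop

theorem norm_setBlock_sub_self (x : Space n) (i : Fin N) (z : EuclideanSpace ℝ (Fin (n i))) :
    ‖setBlock x i z - x‖ = ‖z - x i‖ := by
  rw [setBlock_eq_add, add_sub_cancel_left, norm_blockIncl]

theorem inner_setBlock_sub_self (v x : Space n) (i : Fin N) (z : EuclideanSpace ℝ (Fin (n i))) :
    inner ℝ v (setBlock x i z - x) = inner ℝ (v i) (z - x i) := by
  rw [setBlock_eq_add, add_sub_cancel_left, inner_blockIncl]

theorem hasFDerivAt_setBlock (x : Space n) (i : Fin N) (z : EuclideanSpace ℝ (Fin (n i))) :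
    HasFDerivAt (fun z => setBlock x i z) (blockIncl i) z := by
  have h := ((blockIncl (n := n) i).hasFDerivAt.comp z
    ((hasFDerivAt_id z).sub_const (x i))).const_add x
  exact h.congr_of_eventuallyEq (Eventually.of_forall fun z => setBlock_eq_add x i z)

theorem mix_apply (m : ℕ) (x y : Space n) (j : Fin N) :
    mix m x y j = if (j : ℕ) < m then x j else y j := rfl

@[simp] theorem mix_zero (x y : Space n) : mix 0 x y = y := by
  ext j : 1; simp [mix_apply]

theorem mix_of_le {m : ℕ} (hm : N ≤ m) (x y : Space n) : mix m x y = x := by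
  ext j : 1; simp [mix_apply, j.2.trans_le hm]

@[simp] theorem mix_self (m : ℕ) (x : Space n) : mix m x x = x := by
  ext j : 1; simp [mix_apply]

@[simp] theorem mix_apply_self (i : Fin N) (x y : Space n) : mix (i : ℕ) x y i = y i := by
  simp [mix_apply]

/-- This identifies one Gauss–Seidel update with a block replacement, so that slice statements about
`setBlock` apply to the intermediate points of a sweep. -/
theorem mix_succ (i : Fin N) (x y : Space n) :
    mix ((i : ℕ) + 1) x y = setBlock (mix (i : ℕ) x y) i (x i) := by
  ext j : 1
  by_cases h : j = i
  · subst h; simp [mix_apply]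
  · have : (j : ℕ) ≠ i := fun e => h (Fin.ext e)
    simp only [setBlock, mix_apply, Function.update_of_ne h]
    congr 1
    simp only [eq_iff_iff]; omega

theorem mix_sub (m : ℕ) (x y x' y' : Space n) :
    mix m x y - mix m x' y' = mix m (x - x') (y - y') := by
  ext j : 1
  simp only [PiLp.sub_apply, mix_apply]
  split_ifs <;> rfl

theorem norm_mix_le (m : ℕ) (x y : Space n) : ‖mix m x y‖ ≤ ‖x‖ + ‖y‖ := by
  refine abs_le_of_sq_le_sq' (a := ‖mix m x y‖) ?_ (by positivity) |>.2
  have h : ‖mix m x y‖ ^ 2 ≤ ‖x‖ ^ 2 + ‖y‖ ^ 2 := by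
    rw [PiLp.norm_sq_eq_of_L2, PiLp.norm_sq_eq_of_L2, PiLp.norm_sq_eq_of_L2,
      ← Finset.sum_add_distrib]
    refine Finset.sum_le_sum fun j _ => ?_
    rw [mix_apply]
    split_ifs <;> nlinarith [sq_nonneg ‖x j‖, sq_nonneg ‖y j‖]
  nlinarith [norm_nonneg x, norm_nonneg y]

theorem continuous_mix (m : ℕ) : Continuous fun p : Space n × Space n => mix m p.1 p.2 := by
  simp only [mix]
  apply (PiLp.continuous_toLp 2 _).comp
  refine continuous_pi fun j => ?_
  split_ifs <;> fun_prop

theorem norm_mix_sub_le (m : ℕ) (x y x' y' : Space n) :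
    ‖mix m x y - mix m x' y'‖ ≤ ‖x - x'‖ + ‖y - y'‖ := by
  rw [mix_sub]; exact norm_mix_le _ _ _

theorem norm_mix_sub_left_le (m : ℕ) (x y : Space n) : ‖mix m x y - x‖ ≤ ‖x - y‖ := by
  have := norm_mix_sub_le m x y x x
  rw [mix_self, sub_self, norm_zero, zero_add, norm_sub_rev y x] at this
  exact this

end Blocks

/-! ### Block gradients, Bregman distances and block descent -/

section Gradients

variable {N : ℕ} {n : Fin N → ℕ}

theorem hasFDerivAt_toReal {φ : Space n → EReal} {U : Set (Space n)} (hU : IsOpen U)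
    (hφ : ContDiffOn ℝ 1 (fun y => (φ y).toReal) U) {x : Space n} (hx : x ∈ U) :
    HasFDerivAt (fun y => (φ y).toReal) (innerSL ℝ (grad φ x)) x :=
  (((hφ.contDiffAt (hU.mem_nhds hx)).differentiableAt one_ne_zero).hasGradientAt).hasFDerivAt

theorem continuousOn_grad {φ : Space n → EReal} {U : Set (Space n)} (hU : IsOpen U)
    (hφ : ContDiffOn ℝ 1 (fun y => (φ y).toReal) U) : ContinuousOn (grad φ) U :=
  (LinearIsometryEquiv.continuous _).comp_continuousOn
    (hφ.continuousOn_fderiv_of_isOpen hU le_rfl)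

theorem continuousOn_blockGrad {φ : Space n → EReal} {U : Set (Space n)} (hU : IsOpen U)
    (hφ : ContDiffOn ℝ 1 (fun y => (φ y).toReal) U) (i : Fin N) :
    ContinuousOn (blockGrad φ i) U :=
  (PiLp.continuous_apply 2 _ i).comp_continuousOn (continuousOn_grad hU hφ)

theorem hasFDerivAt_slice {φ : Space n → EReal} {i : Fin N} {x : Space n}
    {z : EuclideanSpace ℝ (Fin (n i))}
    (h : HasFDerivAt (fun y => (φ y).toReal) (innerSL ℝ (grad φ (setBlock x i z)))
      (setBlock x i z)) :
    HasFDerivAt (fun z => (φ (setBlock x i z)).toReal)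
      (innerSL ℝ (blockGrad φ i (setBlock x i z))) z := by
  have := h.comp z (hasFDerivAt_setBlock x i z)
  refine this.congr_fderiv ?_
  ext w
  simp [inner_blockIncl, blockGrad]

/-- The finite part of the Bregman distance. -/
def bregmanReal (h : Space n → EReal) (y x : Space n) : ℝ :=
  (h y).toReal - (h x).toReal - inner ℝ (grad h x) (y - x)

theorem bregman_eq_coe {h : Space n → EReal} {y x : Space n} (hy : y ∈ dom h)
    (hx : x ∈ interior (dom h)) : bregman h y x = bregmanReal h y x :=
  if_pos ⟨hy, hx⟩

theorem bregmanReal_setBlock (h : Space n → EReal) (i : Fin N) (x : Space n)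
    (z : EuclideanSpace ℝ (Fin (n i))) :
    bregmanReal h (setBlock x i z) x =
      (h (setBlock x i z)).toReal - (h x).toReal - inner ℝ (blockGrad h i x) (z - x i) := by
  rw [bregmanReal, inner_setBlock_sub_self, blockGrad]

@[simp] theorem bregmanReal_self (h : Space n → EReal) (x : Space n) : bregmanReal h x x = 0 := by
  simp [bregmanReal]

theorem bregmanReal_setBlock_nonneg {h : Space n → EReal} {i : Fin N} (hb : IsKernelBase h)
    (hc : IsBlockConvex i h) {x : Space n} (hx : x ∈ interior (dom h))
    {z : EuclideanSpace ℝ (Fin (n i))} (hz : setBlock x i z ∈ dom h) :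
    0 ≤ bregmanReal h (setBlock x i z) x := by
  have hd := hasFDerivAt_toReal isOpen_interior hb.contDiffOn hx
  have hd' : HasFDerivAt (fun z => (h (setBlock x i z)).toReal)
      (innerSL ℝ (blockGrad h i x)) (x i) := by
    have := hasFDerivAt_slice (φ := h) (i := i) (x := x) (z := x i) (by simpa using hd)
    simpa using this
  have := convexOn_gradient_ineq (hc x (interior_subset hx)) (a := x i) (b := z)
    (by simpa using interior_subset hx) hz hd'
  rw [bregmanReal_setBlock]
  simp only [setBlock_self, innerSL_apply_apply] at this
  linarith

theorem bregmanReal_setBlock_strong {h : Space n → EReal} {i : Fin N} (hb : IsKernelBase h)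
    {σ : ℝ} (hc : IsBlockStrongConvex i σ h) {x : Space n} (hx : x ∈ interior (dom h))
    {z : EuclideanSpace ℝ (Fin (n i))} (hz : setBlock x i z ∈ dom h) :
    σ / 2 * ‖z - x i‖ ^ 2 ≤ bregmanReal h (setBlock x i z) x := by
  have hd := hasFDerivAt_toReal isOpen_interior hb.contDiffOn hx
  have hd' : HasFDerivAt (fun z => (h (setBlock x i z)).toReal)
      (innerSL ℝ (blockGrad h i x)) (x i) := by
    have := hasFDerivAt_slice (φ := h) (i := i) (x := x) (z := x i) (by simpa using hd)
    simpa using this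
  have := strongConvexOn_gradient_ineq (hc x (interior_subset hx)) (a := x i) (b := z)
    (by simpa using interior_subset hx) hz hd'
  rw [bregmanReal_setBlock]
  simp only [setBlock_self, innerSL_apply_apply] at this
  linarith

/-- The block descent lemma for relatively smooth functions. -/
theorem block_descent {f h : Space n → EReal} {i : Fin N} {L : ℝ} {U : Set (Space n)}
    (hU : IsOpen U) (hf : ContDiffOn ℝ 1 (fun y => (f y).toReal) U)
    (hh : ContDiffOn ℝ 1 (fun y => (h y).toReal) U) {x : Space n} (hx : x ∈ U)
    (hc : ConvexOn ℝ {z | setBlock x i z ∈ U}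
      (fun z => L * (h (setBlock x i z)).toReal - (f (setBlock x i z)).toReal))
    {z : EuclideanSpace ℝ (Fin (n i))} (hz : setBlock x i z ∈ U) :
    (f (setBlock x i z)).toReal ≤ (f x).toReal + inner ℝ (blockGrad f i x) (z - x i) +
      L * bregmanReal h (setBlock x i z) x := by
  have hd1 : HasFDerivAt (fun z => (h (setBlock x i z)).toReal)
      (innerSL ℝ (blockGrad h i x)) (x i) := by
    have := hasFDerivAt_slice (φ := h) (i := i) (x := x) (z := x i)
      (by simpa using hasFDerivAt_toReal hU hh hx)
    simpa using this
  have hd2 : HasFDerivAt (fun z => (f (setBlock x i z)).toReal)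
      (innerSL ℝ (blockGrad f i x)) (x i) := by
    have := hasFDerivAt_slice (φ := f) (i := i) (x := x) (z := x i)
      (by simpa using hasFDerivAt_toReal hU hf hx)
    simpa using this
  have := convexOn_gradient_ineq hc (a := x i) (b := z) (by simpa using hx) hz
    ((hd1.const_mul L).sub hd2)
  rw [bregmanReal_setBlock]
  simp only [setBlock_self, sub_apply, smul_apply,
    innerSL_apply_apply, smul_eq_mul] at this
  linarith

end Gradients

/-! ### Lipschitz dependence of block Bregman distances on base point and displacement -/

section LipschitzBregman

variable {N : ℕ} {n : Fin N → ℕ}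

theorem hasDerivAt_comp_line {φ : Space n → EReal} {i : Fin N} {u : Space n}
    {s v : EuclideanSpace ℝ (Fin (n i))} {t : ℝ}
    (h : HasFDerivAt (fun y => (φ y).toReal)
      (innerSL ℝ (grad φ (u + blockIncl i (s + t • v)))) (u + blockIncl i (s + t • v))) :
    HasDerivAt (fun t : ℝ => (φ (u + blockIncl i (s + t • v))).toReal)
      (inner ℝ (blockGrad φ i (u + blockIncl i (s + t • v))) v) t := by
  have h1 : HasDerivAt (fun t : ℝ => s + t • v) v t := by
    simpa using ((hasDerivAt_id t).smul_const v).const_add s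
  have h2 : HasDerivAt (fun t : ℝ => u + blockIncl (n := n) i (s + t • v)) (blockIncl i v) t :=
    ((blockIncl (n := n) i).hasFDerivAt.comp_hasDerivAt t h1).const_add u
  have h3 := h.comp_hasDerivAt t h2
  rw [innerSL_apply_apply, inner_blockIncl] at h3
  exact h3

/-- The Bregman distance along the `i`-th block as a function of the base point `u` and the
displacement `s`. -/
def blockBregman (h : Space n → EReal) (i : Fin N) (u : Space n)
    (s : EuclideanSpace ℝ (Fin (n i))) : ℝ :=
  (h (u + blockIncl i s)).toReal - (h u).toReal - inner ℝ (blockGrad h i u) s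

theorem bregmanReal_setBlock_eq_blockBregman (h : Space n → EReal) (i : Fin N) (u : Space n)
    (z : EuclideanSpace ℝ (Fin (n i))) :
    bregmanReal h (setBlock u i z) u = blockBregman h i u (z - u i) := by
  rw [bregmanReal_setBlock, blockBregman, setBlock_eq_add]

variable {h : Space n → EReal} {i : Fin N} {Q : Set (Space n)} {K : NNReal}

theorem add_blockIncl_mem (hQ : Convex ℝ Q) {u : Space n}
    {s v : EuclideanSpace ℝ (Fin (n i))} (h0 : u + blockIncl i s ∈ Q)
    (h1 : u + blockIncl i (s + v) ∈ Q) {t : ℝ} (ht : t ∈ Icc (0 : ℝ) 1) :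
    u + blockIncl i (s + t • v) ∈ Q := by
  have := hQ h0 h1 (sub_nonneg.2 ht.2) ht.1 (by ring)
  convert this using 1
  simp only [map_add, map_smul]
  module

/-- The derivative along t • s of the difference is an inner product of s with two gradient
differences, each of norm at most K‖u - u'‖. The factor ‖s‖ matters: at an iterate it makes the
slope proportional to the step. -/
theorem abs_blockBregman_sub_base_le (hQ : Convex ℝ Q)
    (hd : ∀ y ∈ Q, HasFDerivAt (fun y => (h y).toReal) (innerSL ℝ (grad h y)) y)
    (hL : LipschitzOnWith K (blockGrad h i) Q) {u u' : Space n}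
    {s : EuclideanSpace ℝ (Fin (n i))} (hu : u ∈ Q) (hu' : u' ∈ Q)
    (hus : u + blockIncl i s ∈ Q) (hus' : u' + blockIncl i s ∈ Q) :
    |blockBregman h i u s - blockBregman h i u' s| ≤ 2 * K * ‖u - u'‖ * ‖s‖ := by
  have hm : ∀ t ∈ Icc (0 : ℝ) 1, u + blockIncl i (0 + t • s) ∈ Q := fun t ht =>
    add_blockIncl_mem hQ (by simpa using hu) (by simpa using hus) ht
  have hm' : ∀ t ∈ Icc (0 : ℝ) 1, u' + blockIncl i (0 + t • s) ∈ Q := fun t ht =>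
    add_blockIncl_mem hQ (by simpa using hu') (by simpa using hus') ht
  have key := norm_image_sub_le_of_norm_deriv_le_segment_01'
    (f := fun t : ℝ => (h (u + blockIncl i (0 + t • s))).toReal -
      (h (u' + blockIncl i (0 + t • s))).toReal -
      t * inner ℝ (blockGrad h i u - blockGrad h i u') s)
    (f' := fun t : ℝ => inner ℝ (blockGrad h i (u + blockIncl i (0 + t • s))) s -
      inner ℝ (blockGrad h i (u' + blockIncl i (0 + t • s))) s -
      1 * inner ℝ (blockGrad h i u - blockGrad h i u') s)
    (C := 2 * K * ‖u - u'‖ * ‖s‖)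
    (fun t ht => (((hasDerivAt_comp_line (hd _ (hm t ht))).sub
      (hasDerivAt_comp_line (hd _ (hm' t ht)))).sub
      ((hasDerivAt_id t).mul_const _)).hasDerivWithinAt) ?_
  · rw [Real.norm_eq_abs] at key
    refine le_of_eq_of_le ?_ key
    congr 1
    simp only [blockBregman, inner_sub_left, zero_add, one_smul, zero_smul, map_zero, add_zero]
    ring
  · intro t ht
    have ht' := Ico_subset_Icc_self ht
    rw [one_mul, ← inner_sub_left, ← inner_sub_left]
    refine (norm_inner_le_norm _ _).trans (mul_le_mul_of_nonneg_right ?_ (norm_nonneg _))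
    have h1 := hL.norm_sub_le (hm t ht') (hm' t ht')
    have h2 := hL.norm_sub_le hu hu'
    rw [add_sub_add_right_eq_sub] at h1
    have := norm_sub_le (blockGrad h i (u + blockIncl i (0 + t • s)) -
      blockGrad h i (u' + blockIncl i (0 + t • s))) (blockGrad h i u - blockGrad h i u')
    linarith

/-- The derivative in the displacement is the gradient increment from u, which is at most K times
the displacement; on the segment from s' to s this has norm at most ‖s'‖ + ‖s - s'‖. -/
theorem abs_blockBregman_sub_disp_le (hQ : Convex ℝ Q)
    (hd : ∀ y ∈ Q, HasFDerivAt (fun y => (h y).toReal) (innerSL ℝ (grad h y)) y)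
    (hL : LipschitzOnWith K (blockGrad h i) Q) {u : Space n}
    {s s' : EuclideanSpace ℝ (Fin (n i))} (hu : u ∈ Q)
    (hus : u + blockIncl i s ∈ Q) (hus' : u + blockIncl i s' ∈ Q) :
    |blockBregman h i u s - blockBregman h i u s'| ≤ K * (‖s'‖ + ‖s - s'‖) * ‖s - s'‖ := by
  have hm : ∀ t ∈ Icc (0 : ℝ) 1, u + blockIncl i (s' + t • (s - s')) ∈ Q := fun t ht =>
    add_blockIncl_mem hQ hus' (by simpa using hus) ht
  have key := norm_image_sub_le_of_norm_deriv_le_segment_01'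
    (f := fun t : ℝ => (h (u + blockIncl i (s' + t • (s - s')))).toReal -
      t * inner ℝ (blockGrad h i u) (s - s'))
    (f' := fun t : ℝ => inner ℝ (blockGrad h i (u + blockIncl i (s' + t • (s - s')))) (s - s') -
      1 * inner ℝ (blockGrad h i u) (s - s'))
    (C := K * (‖s'‖ + ‖s - s'‖) * ‖s - s'‖)
    (fun t ht => ((hasDerivAt_comp_line (hd _ (hm t ht))).sub
      ((hasDerivAt_id t).mul_const _)).hasDerivWithinAt) ?_
  · rw [Real.norm_eq_abs] at key
    refine le_of_eq_of_le ?_ key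
    congr 1
    simp only [blockBregman, inner_sub_right, one_smul, zero_smul, add_zero, add_sub_cancel]
    ring
  · intro t ht
    rw [one_mul, ← inner_sub_left]
    refine (norm_inner_le_norm _ _).trans (mul_le_mul_of_nonneg_right ?_ (norm_nonneg _))
    have h1 := hL.norm_sub_le (hm t (Ico_subset_Icc_self ht)) hu
    rw [add_sub_cancel_left, norm_blockIncl] at h1
    refine h1.trans (mul_le_mul_of_nonneg_left ?_ K.2)
    refine (norm_add_le _ _).trans (add_le_add_right ?_ _)
    rw [norm_smul, Real.norm_of_nonneg ht.1]
    exact mul_le_of_le_one_left (norm_nonneg _) ht.2.le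

end LipschitzBregman

/-! ### Finite sums and lower semicontinuity in the extended reals -/

section EReal

theorem ereal_sum_coe {ι : Type*} (s : Finset ι) (a : ι → ℝ) :
    ∑ i ∈ s, ((a i : ℝ) : EReal) = ((∑ i ∈ s, a i : ℝ) : EReal) := by
  classical
  induction s using Finset.induction_on with
  | empty => simp
  | insert i s hi ih => rw [Finset.sum_insert hi, Finset.sum_insert hi, ih, EReal.coe_add]

theorem ereal_sum_ne_bot {ι : Type*} (s : Finset ι) {a : ι → EReal} (h : ∀ i ∈ s, a i ≠ ⊥) :
    ∑ i ∈ s, a i ≠ ⊥ := by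
  classical
  induction s using Finset.induction_on with
  | empty => simp
  | insert i s hi ih =>
    rw [Finset.sum_insert hi, Ne, EReal.add_eq_bot_iff]
    push Not
    exact ⟨h i (by simp), ih fun j hj => h j (by simp [hj])⟩

theorem ereal_sum_eq_top {ι : Type*} {s : Finset ι} {a : ι → EReal} (h : ∀ i ∈ s, a i ≠ ⊥)
    {i : ι} (hi : i ∈ s) (ht : a i = ⊤) : ∑ i ∈ s, a i = ⊤ := by
  classical
  rw [← Finset.add_sum_erase s a hi, ht]
  exact EReal.top_add_of_ne_bot (ereal_sum_ne_bot _ fun j hj => h j (Finset.mem_of_mem_erase hj))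

theorem lowerSemicontinuousOn_sum {X ι : Type*} [TopologicalSpace X] {S : Set X} (s : Finset ι)
    {a : ι → X → EReal} (hb : ∀ i ∈ s, ∀ x ∈ S, a i x ≠ ⊥)
    (h : ∀ i ∈ s, LowerSemicontinuousOn (a i) S) :
    LowerSemicontinuousOn (fun x => ∑ i ∈ s, a i x) S := by
  classical
  induction s using Finset.induction_on with
  | empty => simpa using lowerSemicontinuousOn_const
  | insert i s hi ih =>
    simp only [Finset.sum_insert hi]
    refine (h i (by simp)).add' (ih (fun j hj => hb j (by simp [hj]))
      fun j hj => h j (by simp [hj])) fun x hx => ?_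
    exact EReal.continuousAt_add
      (Or.inr (ereal_sum_ne_bot _ fun j hj => hb j (by simp [hj]) x hx))
      (Or.inl (hb i (by simp) x hx))

end EReal

variable {N : ℕ} {n : Fin N → ℕ}

/-! ### Finiteness and semicontinuity of the cost -/

section Cost

variable {f : Space n → EReal} {g : ∀ i, EuclideanSpace ℝ (Fin (n i)) → EReal}

/-- The finite part of the cost. -/
def costReal (f : Space n → EReal) (g : ∀ i, EuclideanSpace ℝ (Fin (n i)) → EReal)
    (x : Space n) : ℝ :=
  (f x).toReal + ∑ i, (g i (x i)).toReal

theorem cost_eq_coe (hf : IsProper f) (hg : ∀ i, IsProper (g i)) {x : Space n} (hx : x ∈ dom f)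
    (hgx : ∀ i, g i (x i) ≠ ⊤) : cost f g x = costReal f g x := by
  rw [cost, costReal, EReal.coe_add, EReal.coe_toReal (ne_of_lt hx) (hf.1 x), ← ereal_sum_coe]
  congr 1
  exact Finset.sum_congr rfl fun i _ => (EReal.coe_toReal (hgx i) ((hg i).1 _)).symm

theorem cost_eq_top (hf : IsProper f) (hg : ∀ i, IsProper (g i)) {x : Space n} {i : Fin N}
    (hgx : g i (x i) = ⊤) : cost f g x = ⊤ := by
  rw [cost, ereal_sum_eq_top (fun i _ => (hg i).1 _) (Finset.mem_univ i) hgx]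
  exact EReal.add_top_of_ne_bot (hf.1 x)

theorem cost_ne_bot (hf : IsProper f) (hg : ∀ i, IsProper (g i)) (x : Space n) :
    cost f g x ≠ ⊥ := by
  rw [cost, Ne, EReal.add_eq_bot_iff]
  push Not
  exact ⟨hf.1 x, ereal_sum_ne_bot _ fun i _ => (hg i).1 _⟩

theorem lowerSemicontinuous_cost (hf : IsProper f) (hg : ∀ i, IsProper (g i))
    (hfl : LowerSemicontinuous f) (hgl : ∀ i, LowerSemicontinuous (g i)) :
    LowerSemicontinuous (cost f g) := by
  rw [← lowerSemicontinuousOn_univ_iff]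
  refine (lowerSemicontinuousOn_univ_iff.2 hfl).add' (g := fun x => ∑ i, g i (x i)) ?_ ?_
  · refine lowerSemicontinuousOn_sum _ (fun i _ x _ => (hg i).1 _) fun i _ => ?_
    exact lowerSemicontinuousOn_univ_iff.2 ((hgl i).comp (PiLp.continuous_apply 2 _ i))
  · intro x _
    exact EReal.continuousAt_add
      (Or.inr (ereal_sum_ne_bot Finset.univ (a := fun i => g i (x i)) fun i _ => (hg i).1 _))
      (Or.inl (hf.1 x))

end Cost

/-! ### The block subproblem as a real inequality -/

section Prox

variable {f : Space n → EReal} {g : ∀ i, EuclideanSpace ℝ (Fin (n i)) → EReal}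
  {h : Fin N → Space n → EReal} {i : Fin N} {γ α : ℝ} {u y : Space n}
  {z : EuclideanSpace ℝ (Fin (n i))}

theorem model_eq_coe (hg : IsProper (g i)) (hu : u ∈ interior (dom (h i)))
    (hz : setBlock u i z ∈ dom (h i)) (hgz : g i z ≠ ⊤) :
    model f g h i γ α u y z =
      ((inner ℝ (blockGrad f i u - (α / γ) • (u i - y i)) (z - u i) +
        1 / γ * bregmanReal (h i) (setBlock u i z) u + (g i z).toReal : ℝ) : EReal) := by
  rw [model, bregman_eq_coe hz hu, EReal.coe_add, EReal.coe_add, EReal.coe_mul,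
    EReal.coe_toReal hgz (hg.1 z)]

theorem proxMap_finite (hg : IsProper (g i)) (hγ : 0 < γ)
    (hz : z ∈ proxMap f g h i γ α u y) : g i z ≠ ⊤ ∧ setBlock u i z ∈ dom (h i) := by
  have h1 := hz.1.ne
  rw [model] at h1
  have hb : bregman (h i) (setBlock u i z) u ≠ ⊤ := by
    intro hb
    rw [hb, EReal.coe_mul_top_of_pos (by positivity), EReal.coe_add_top,
      EReal.top_add_of_ne_bot (hg.1 z)] at h1
    exact h1 rfl
  have hd : setBlock u i z ∈ dom (h i) ∧ u ∈ interior (dom (h i)) := by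
    by_contra hn
    exact hb (if_neg hn)
  refine ⟨fun ht => h1 ?_, hd.1⟩
  rw [ht, bregman_eq_coe hd.1 hd.2, ← EReal.coe_mul, ← EReal.coe_add, EReal.coe_add_top]

theorem proxMap_ineq (hg : IsProper (g i)) (hγ : 0 < γ) (hu : u ∈ interior (dom (h i)))
    (hz : z ∈ proxMap f g h i γ α u y) {w : EuclideanSpace ℝ (Fin (n i))}
    (hw : setBlock u i w ∈ dom (h i)) (hgw : g i w ≠ ⊤) :
    inner ℝ (blockGrad f i u - (α / γ) • (u i - y i)) (z - u i) +
        1 / γ * bregmanReal (h i) (setBlock u i z) u + (g i z).toReal ≤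
      inner ℝ (blockGrad f i u - (α / γ) • (u i - y i)) (w - u i) +
        1 / γ * bregmanReal (h i) (setBlock u i w) u + (g i w).toReal := by
  obtain ⟨h1, h2⟩ := proxMap_finite hg hγ hz
  have := hz.2 w
  rw [model_eq_coe hg hu h2 h1, model_eq_coe hg hu hw hgw] at this
  exact_mod_cast this

end Prox

/-! ### Feasibility of the iterates and decrease of the energy -/

section Setting

/-- The standing hypotheses on the problem, the parameters and the iterates. -/
structure Setting [NeZero N] (C : Set (Space n)) (f : Space n → EReal)
    (g : ∀ i, EuclideanSpace ℝ (Fin (n i)) → EReal) (h : Fin N → Space n → EReal)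
    (L σ δ : Fin N → ℝ) (γ α : ℕ → Fin N → ℝ) (xm : Space n) (x : ℕ → Space n) : Prop where
  basic : BasicAssumption C f g h L
  prox : ProxIntoC C f g h L γ α
  closure_subset : closure C ⊆ interior (dom (h 0))
  σ_pos : ∀ i, 0 < σ i
  strong : ∀ i, IsBlockStrongConvex i (σ i) (h i)
  param : ParamRule L σ δ γ α
  seq : IsBIBPASeq f g h γ α xm x

namespace Setting

variable [NeZero N] {C : Set (Space n)} {f : Space n → EReal}
  {g : ∀ i, EuclideanSpace ℝ (Fin (n i)) → EReal} {h : Fin N → Space n → EReal}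
  {L σ δ : Fin N → ℝ} {γ α : ℕ → Fin N → ℝ} {xm : Space n} {x : ℕ → Space n}

section Params

variable (S : Setting C f g h L σ δ γ α xm x)
include S

theorem exists_gamma_low : ∃ c : ℝ, 0 < c ∧ ∀ k i, c ≤ γ k i := by
  obtain ⟨_, γl, hl⟩ := S.param.limits
  obtain ⟨i₀, hi₀⟩ := Finite.exists_min γl
  exact ⟨γl i₀, (hl i₀).2.1, fun k i => (hi₀ i).trans ((hl i).2.2.2 k)⟩

theorem gamma_pos (k : ℕ) (i : Fin N) : 0 < γ k i := by
  obtain ⟨c, hc, hcl⟩ := S.exists_gamma_low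
  exact hc.trans_le (hcl k i)

theorem L_pos (i : Fin N) : 0 < L i := S.basic.f_relSmooth.pos i

theorem delta_nonneg (i : Fin N) : 0 ≤ δ i := by
  have h1 := S.param.b_nonneg 0 i
  have h2 := mul_pos (S.σ_pos i) (S.gamma_pos 0 i)
  have : 0 ≤ |α 0 i| / (σ i * γ 0 i) := by positivity
  rw [bCoef] at h1
  linarith

theorem aCoef_eq (k : ℕ) (i : Fin N) :
    aCoef L σ δ γ α k i = 1 / γ k i - L i - |α k i| / (σ i * γ k i) - δ i := by
  have := S.gamma_pos k i
  rw [aCoef, sub_div, mul_div_cancel_left₀ _ this.ne']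

/-- The strict bound comes from nondegeneracy: δ cancels in a_i^k + b_i^{k+1}, leaving 1/γ - L minus
two nonnegative terms, and this is at least ρ > 0. The upper rule for γ alone would allow γ = 1/L
when α = 0. -/
theorem gamma_mem (k : ℕ) (i : Fin N) : γ k i ∈ Ioo 0 (1 / L i) := by
  obtain ⟨ρ, hρ, hab⟩ := S.param.nondegenerate
  have hγ := S.gamma_pos k i
  have h1 := hab k i
  have h2 : 0 ≤ |α k i| / (σ i * γ k i) :=
    div_nonneg (abs_nonneg _) (mul_pos (S.σ_pos i) hγ).le
  have h3 : 0 ≤ |α (k + 1) i| / (σ i * γ (k + 1) i) :=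
    div_nonneg (abs_nonneg _) (mul_pos (S.σ_pos i) (S.gamma_pos (k + 1) i)).le
  rw [S.aCoef_eq, bCoef] at h1
  refine ⟨hγ, ?_⟩
  rw [lt_one_div hγ (S.L_pos i)]
  linarith

theorem interior_dom (i : Fin N) : interior (dom (h i)) = interior (dom (h 0)) := S.basic.h_dom i

theorem mem_dom {y : Space n} (hy : y ∈ interior (dom (h 0))) (i : Fin N) : y ∈ dom (h i) :=
  interior_subset ((S.interior_dom i).symm ▸ hy)

theorem mem_int {y : Space n} (hy : y ∈ interior (dom (h 0))) (i : Fin N) :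
    y ∈ interior (dom (h i)) := (S.interior_dom i).symm ▸ hy

theorem C_sub {y : Space n} (hy : y ∈ C) : y ∈ interior (dom (h 0)) :=
  S.closure_subset (subset_closure hy)

theorem h_contDiffOn (i : Fin N) :
    ContDiffOn ℝ 1 (fun y => (h i y).toReal) (interior (dom (h 0))) := by
  have := (S.basic.h_legendre i).base.contDiffOn
  rwa [S.interior_dom i] at this

theorem h_hasFDerivAt (i : Fin N) {y : Space n} (hy : y ∈ interior (dom (h 0))) :
    HasFDerivAt (fun y => (h i y).toReal) (innerSL ℝ (grad (h i) y)) y :=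
  hasFDerivAt_toReal isOpen_interior (S.h_contDiffOn i) hy

theorem f_hasFDerivAt {y : Space n} (hy : y ∈ interior (dom (h 0))) :
    HasFDerivAt (fun y => (f y).toReal) (innerSL ℝ (grad f y)) y :=
  hasFDerivAt_toReal isOpen_interior S.basic.f_contDiffOn hy

/-- Induction along one sweep. Membership in C is claimed only after a first block update, because
the starting point x^0 need not lie in C. -/
theorem mix_succ_mem_of (k : ℕ) (hx : x k ∈ interior (dom (h 0)))
    (hp : prev xm x k ∈ interior (dom (h 0))) (m : ℕ) (hm : m ≤ N) :
    mix m (x (k + 1)) (x k) ∈ interior (dom (h 0)) ∧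
      (0 < m → mix m (x (k + 1)) (x k) ∈ C) := by
  induction m with
  | zero => simpa using hx
  | succ m ih =>
    have h1 := (ih (by omega)).1
    have hs := S.seq.step k ⟨m, by omega⟩
    have hC := S.prox k ⟨m, by omega⟩ (S.gamma_mem k _) _ h1 _ hp _ hs
    have e := mix_succ (⟨m, by omega⟩ : Fin N) (x (k + 1)) (x k)
    simp only at e hC
    rw [← e] at hC
    exact ⟨S.C_sub hC, fun _ => hC⟩

theorem iterate_mem_int (k : ℕ) :
    x k ∈ interior (dom (h 0)) ∧ prev xm x k ∈ interior (dom (h 0)) := by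
  induction k with
  | zero => exact ⟨S.seq.init, S.seq.init_prev⟩
  | succ k ih =>
    refine ⟨?_, ih.1⟩
    have := (S.mix_succ_mem_of k ih.1 ih.2 N le_rfl).1
    rwa [mix_of_le le_rfl] at this

theorem mix_mem_int (k m : ℕ) : mix m (x (k + 1)) (x k) ∈ interior (dom (h 0)) := by
  rcases le_total m N with hm | hm
  · exact (S.mix_succ_mem_of k (S.iterate_mem_int k).1 (S.iterate_mem_int k).2 m hm).1
  · rw [mix_of_le hm]; exact (S.iterate_mem_int (k + 1)).1

theorem iterate_mem_C (k : ℕ) : x (k + 1) ∈ C := by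
  have := (S.mix_succ_mem_of k (S.iterate_mem_int k).1 (S.iterate_mem_int k).2 N le_rfl).2
    (NeZero.pos N)
  rwa [mix_of_le le_rfl] at this

/-- With the index shifted by one, the start of the sweep lies in C as well. -/
theorem mix_mem_C (k m : ℕ) : mix m (x (k + 2)) (x (k + 1)) ∈ C := by
  rcases le_total m N with hm | hm
  · rcases Nat.eq_zero_or_pos m with rfl | h0
    · rw [mix_zero]; exact S.iterate_mem_C k
    · exact (S.mix_succ_mem_of (k + 1) (S.iterate_mem_int _).1 (S.iterate_mem_int _).2 m hm).2 h0
  · rw [mix_of_le hm]; exact S.iterate_mem_C (k + 1)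

theorem g_ne_top (k : ℕ) (i : Fin N) : g i (x (k + 1) i) ≠ ⊤ :=
  (proxMap_finite (S.basic.g_proper i) (S.gamma_pos k i) (S.seq.step k i)).1

theorem f_proper : IsProper f := S.basic.f_relSmooth.proper

theorem mem_dom_f {y : Space n} (hy : y ∈ interior (dom (h 0))) : y ∈ dom f := S.basic.f_finite hy

/-- The basic inequality satisfied by the iterates. -/
theorem step_ineq (k : ℕ) (i : Fin N) {w : EuclideanSpace ℝ (Fin (n i))}
    (hw : setBlock (mix i (x (k + 2)) (x (k + 1))) i w ∈ interior (dom (h 0)))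
    (hgw : g i w ≠ ⊤) :
    inner ℝ (blockGrad f i (mix i (x (k + 2)) (x (k + 1))) -
          (α (k + 1) i / γ (k + 1) i) • (x (k + 1) i - x k i)) (x (k + 2) i - x (k + 1) i) +
        1 / γ (k + 1) i * bregmanReal (h i) (mix (i + 1) (x (k + 2)) (x (k + 1)))
          (mix i (x (k + 2)) (x (k + 1))) + (g i (x (k + 2) i)).toReal ≤
      inner ℝ (blockGrad f i (mix i (x (k + 2)) (x (k + 1))) -
          (α (k + 1) i / γ (k + 1) i) • (x (k + 1) i - x k i)) (w - x (k + 1) i) +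
        1 / γ (k + 1) i * bregmanReal (h i) (setBlock (mix i (x (k + 2)) (x (k + 1))) i w)
          (mix i (x (k + 2)) (x (k + 1))) + (g i w).toReal := by
  have := proxMap_ineq (S.basic.g_proper i) (S.gamma_pos (k + 1) i)
    (S.mem_int (S.mix_mem_int (k + 1) i) i) (S.seq.step (k + 1) i) (S.mem_dom hw i) hgw
  simpa only [mix_apply_self, prev, ← mix_succ] using this

end Params

section Decrease

variable (S : Setting C f g h L σ δ γ α xm x)

/-- The Bregman distance `D_{h_i}(x^{k,i}, x^{k,i-1})`. -/
def stepBregman (h : Fin N → Space n → EReal) (x : ℕ → Space n) (k : ℕ) (i : Fin N) : ℝ :=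
  bregmanReal (h i) (mix ((i : ℕ) + 1) (x (k + 1)) (x k)) (mix (i : ℕ) (x (k + 1)) (x k))

/-- The value of the Lyapunov function at `(x^{k+1}, x^k)`. -/
def energy (f : Space n → EReal) (g : ∀ i, EuclideanSpace ℝ (Fin (n i)) → EReal)
    (h : Fin N → Space n → EReal) (δ : Fin N → ℝ) (x : ℕ → Space n) (k : ℕ) : ℝ :=
  costReal f g (x (k + 1)) + ∑ i, δ i * stepBregman h x k i

include S

theorem stepBregman_ge (k : ℕ) (i : Fin N) :
    σ i / 2 * ‖x (k + 1) i - x k i‖ ^ 2 ≤ stepBregman h x k i := by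
  have := bregmanReal_setBlock_strong (S.basic.h_legendre i).base (S.strong i)
    (S.mem_int (S.mix_mem_int k i) i) (z := x (k + 1) i)
    (by rw [← mix_succ]; exact S.mem_dom (S.mix_mem_int k _) i)
  rwa [← mix_succ, mix_apply_self] at this

theorem stepBregman_nonneg (k : ℕ) (i : Fin N) : 0 ≤ stepBregman h x k i :=
  le_trans (by have := S.σ_pos i; positivity) (S.stepBregman_ge k i)

/-- The subproblem is tested with the unchanged block and combined with block descent for f, which
leaves -(1/γ - L) times the new Bregman distance and the inertial term. By Young's inequality and
strong convexity, σ times the product of the two block steps is at most the sum of the old and new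
Bregman distances. -/
theorem block_decrease (k : ℕ) (i : Fin N) :
    (f (mix ((i : ℕ) + 1) (x (k + 2)) (x (k + 1)))).toReal + (g i (x (k + 2) i)).toReal ≤
      (f (mix (i : ℕ) (x (k + 2)) (x (k + 1)))).toReal + (g i (x (k + 1) i)).toReal -
        (aCoef L σ δ γ α (k + 1) i + δ i) * stepBregman h x (k + 1) i +
        (δ i - bCoef σ δ γ α (k + 1) i) * stepBregman h x k i := by
  have hγ := S.gamma_pos (k + 1) i
  have hσ := S.σ_pos i
  have h1 := S.step_ineq k i (w := x (k + 1) i)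
    (by have := S.mix_mem_int (k + 1) i
        have e := setBlock_self (mix (i : ℕ) (x (k + 2)) (x (k + 1))) i
        rw [mix_apply_self] at e; rwa [e]) (S.g_ne_top k i)
  have e := setBlock_self (mix (i : ℕ) (x (k + 2)) (x (k + 1))) i
  rw [mix_apply_self] at e
  rw [e, bregmanReal_self, sub_self, inner_zero_right, mul_zero, inner_sub_left,
    real_inner_smul_left] at h1
  have h2 := block_descent isOpen_interior S.basic.f_contDiffOn (S.h_contDiffOn i)
    (S.mix_mem_int (k + 1) i) (i := i) (L := L i) (z := x (k + 2) i)
    (by have := S.basic.f_relSmooth.convex i _ (S.mem_int (S.mix_mem_int (k + 1) i) i)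
        rwa [S.interior_dom i] at this)
    (by rw [← mix_succ]; exact S.mix_mem_int (k + 1) _)
  rw [← mix_succ, mix_apply_self] at h2
  have h3 := S.stepBregman_ge k i
  have h4 := S.stepBregman_ge (k + 1) i
  have h5 : α (k + 1) i / γ (k + 1) i *
      inner ℝ (x (k + 1) i - x k i) (x (k + 2) i - x (k + 1) i) ≤
      |α (k + 1) i| / (σ i * γ (k + 1) i) *
        (stepBregman h x k i + stepBregman h x (k + 1) i) := by
    have h6 : α (k + 1) i * inner ℝ (x (k + 1) i - x k i) (x (k + 2) i - x (k + 1) i) ≤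
        |α (k + 1) i| * (‖x (k + 1) i - x k i‖ * ‖x (k + 2) i - x (k + 1) i‖) := by
      refine (le_abs_self _).trans ?_
      rw [abs_mul]
      exact mul_le_mul_of_nonneg_left (abs_real_inner_le_norm _ _) (abs_nonneg _)
    have h7 : σ i * (‖x (k + 1) i - x k i‖ * ‖x (k + 2) i - x (k + 1) i‖) ≤
        stepBregman h x k i + stepBregman h x (k + 1) i := by
      nlinarith [sq_nonneg (‖x (k + 1) i - x k i‖ - ‖x (k + 2) i - x (k + 1) i‖)]
    rw [div_mul_eq_mul_div, div_mul_eq_mul_div, div_le_div_iff₀ hγ (by positivity)]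
    have h8 := mul_le_mul_of_nonneg_left h7 (abs_nonneg (α (k + 1) i))
    nlinarith [mul_le_mul_of_nonneg_right h6 (mul_pos hσ hγ).le,
      mul_le_mul_of_nonneg_right h8 hγ.le]
  have hD : stepBregman h x (k + 1) i = bregmanReal (h i)
    (mix ((i : ℕ) + 1) (x (k + 2)) (x (k + 1))) (mix (i : ℕ) (x (k + 2)) (x (k + 1))) := rfl
  rw [← hD] at h1 h2
  rw [S.aCoef_eq, bCoef]
  linarith

/-- The values of f at the intermediate points telescope over the blocks; the weights δ shift the
old Bregman distances into the energy. -/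
theorem energy_succ_le (k : ℕ) :
    energy f g h δ x (k + 1) ≤ energy f g h δ x k -
      ∑ i, (aCoef L σ δ γ α (k + 1) i * stepBregman h x (k + 1) i +
        bCoef σ δ γ α (k + 1) i * stepBregman h x k i) := by
  have h1 := Finset.sum_le_sum fun (i : Fin N) (_ : i ∈ Finset.univ) => S.block_decrease k i
  have h2 : ∑ i : Fin N, ((f (mix ((i : ℕ) + 1) (x (k + 2)) (x (k + 1)))).toReal -
      (f (mix (i : ℕ) (x (k + 2)) (x (k + 1)))).toReal) =
      (f (x (k + 2))).toReal - (f (x (k + 1))).toReal := by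
    rw [Fin.sum_univ_eq_sum_range (fun m => (f (mix (m + 1) (x (k + 2)) (x (k + 1)))).toReal -
      (f (mix m (x (k + 2)) (x (k + 1)))).toReal) N,
      Finset.sum_range_sub (fun m => (f (mix m (x (k + 2)) (x (k + 1)))).toReal),
      mix_of_le le_rfl, mix_zero]
  simp only [energy, costReal]
  simp only [Finset.sum_add_distrib, Finset.sum_sub_distrib, add_mul, sub_mul] at h1 h2 ⊢
  linarith

theorem energy_antitone : Antitone (energy f g h δ x) := by
  refine antitone_nat_of_succ_le fun k => (S.energy_succ_le k).trans ?_
  rw [sub_le_self_iff]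
  exact Finset.sum_nonneg fun i _ => add_nonneg
    (mul_nonneg (S.param.a_nonneg _ i) (S.stepBregman_nonneg _ i))
    (mul_nonneg (S.param.b_nonneg _ i) (S.stepBregman_nonneg _ i))

/-- The Bregman distance of step k + 1 occurs with weight a^{k+1} in one decrement and with weight
b^{k+2} in the next. Only the sum of these weights is bounded below, hence the difference over two
indices. -/
theorem exists_energy_decrease : ∃ c : ℝ, 0 < c ∧ ∀ k,
    c * ‖x (k + 2) - x (k + 1)‖ ^ 2 ≤ energy f g h δ x k - energy f g h δ x (k + 2) := by
  obtain ⟨ρ, hρ, hab⟩ := S.param.nondegenerate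
  obtain ⟨i₀, hsl⟩ := Finite.exists_min σ
  set s := σ i₀
  have hs0 : 0 < s := S.σ_pos i₀
  refine ⟨ρ * (s / 2), by positivity, fun k => ?_⟩
  have h1 := S.energy_succ_le k
  have h2 := S.energy_succ_le (k + 1)
  have h3 : ρ * (s / 2) * ‖x (k + 2) - x (k + 1)‖ ^ 2 ≤
      ∑ i, (aCoef L σ δ γ α (k + 1) i * stepBregman h x (k + 1) i +
        bCoef σ δ γ α (k + 1) i * stepBregman h x k i) +
      ∑ i, (aCoef L σ δ γ α (k + 2) i * stepBregman h x (k + 2) i +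
        bCoef σ δ γ α (k + 2) i * stepBregman h x (k + 1) i) := by
    rw [PiLp.norm_sq_eq_of_L2, Finset.mul_sum, ← Finset.sum_add_distrib]
    refine Finset.sum_le_sum fun i _ => ?_
    have e1 := mul_nonneg (S.param.b_nonneg (k + 1) i) (S.stepBregman_nonneg k i)
    have e2 := mul_nonneg (S.param.a_nonneg (k + 2) i) (S.stepBregman_nonneg (k + 2) i)
    have e3 := mul_le_mul_of_nonneg_right (hab (k + 1) i) (S.stepBregman_nonneg (k + 1) i)
    have e4 : s / 2 * ‖x (k + 2) i - x (k + 1) i‖ ^ 2 ≤ stepBregman h x (k + 1) i :=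
      le_trans (mul_le_mul_of_nonneg_right (by linarith [hsl i]) (sq_nonneg _))
        (S.stepBregman_ge (k + 1) i)
    have e5 := mul_le_mul_of_nonneg_left e4 hρ.le
    rw [PiLp.sub_apply]
    have : k + 1 + 1 = k + 2 := rfl
    rw [this] at e3
    linarith
  have e : k + 1 + 1 = k + 2 := rfl
  rw [e] at h2
  linarith

theorem energy_bddBelow : BddBelow (range (energy f g h δ x)) := by
  obtain ⟨y, hy, hmin⟩ := S.basic.argmin_nonempty
  have hx : ∀ k, cost f g (x (k + 1)) = costReal f g (x (k + 1)) := fun k =>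
    cost_eq_coe S.f_proper S.basic.g_proper (S.mem_dom_f (S.iterate_mem_int _).1) (S.g_ne_top k)
  have hle : ∀ k, cost f g y ≤ costReal f g (x (k + 1)) := fun k => by
    rw [← hx]; exact hmin _ (subset_closure (S.iterate_mem_C k))
  have hne : cost f g y ≠ ⊤ := ne_top_of_le_ne_top (EReal.coe_ne_top _) (hle 0)
  have hnb := cost_ne_bot S.f_proper S.basic.g_proper y
  refine ⟨(cost f g y).toReal, ?_⟩
  rintro _ ⟨k, rfl⟩
  have h1 : (cost f g y).toReal ≤ costReal f g (x (k + 1)) := by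
    have := hle k
    rw [← EReal.coe_toReal hne hnb] at this
    exact_mod_cast this
  refine h1.trans (le_add_of_nonneg_right ?_)
  exact Finset.sum_nonneg fun i _ => mul_nonneg (S.delta_nonneg i) (S.stepBregman_nonneg k i)

theorem exists_energy_lim : ∃ Es, Tendsto (energy f g h δ x) atTop (𝓝 Es) :=
  ⟨_, tendsto_atTop_ciInf S.energy_antitone S.energy_bddBelow⟩

theorem tendsto_step_zero : Tendsto (fun k => ‖x (k + 1) - x k‖) atTop (𝓝 0) := by
  obtain ⟨Es, hEs⟩ := S.exists_energy_lim
  obtain ⟨c, hc, hdec⟩ := S.exists_energy_decrease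
  have h1 : Tendsto (fun k => (energy f g h δ x k - energy f g h δ x (k + 2)) / c) atTop (𝓝 0) := by
    have := (hEs.sub (hEs.comp (tendsto_add_atTop_nat 2))).div_const c
    simpa using this
  have h2 : Tendsto (fun k => ‖x (k + 2) - x (k + 1)‖ ^ 2) atTop (𝓝 0) :=
    squeeze_zero (fun _ => sq_nonneg _)
      (fun k => by rw [le_div_iff₀ hc, mul_comm]; exact hdec k) h1
  have h3 := h2.sqrt
  simp only [Real.sqrt_sq (norm_nonneg _), Real.sqrt_zero] at h3
  exact (tendsto_add_atTop_iff_nat (f := fun k => ‖x (k + 1) - x k‖) 1).1 h3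

end Decrease

end Setting

end Setting

/-! ### Lower slopes of the cost and of the Bregman terms -/

section Slopes

theorem norm_apply_sub_le (x y : Space n) (i : Fin N) : ‖x i - y i‖ ≤ ‖x - y‖ := by
  rw [← PiLp.sub_apply]; exact PiLp.norm_apply_le _ _

theorem inner_eq_sum_blockGrad (f : Space n → EReal) (p v : Space n) :
    inner ℝ (grad f p) v = ∑ i, inner ℝ (blockGrad f i p) (v i) := PiLp.inner_apply _ _

theorem eventually_abs_taylor_le {F : Type*} [NormedAddCommGroup F] [NormedSpace ℝ F]
    {φ : F → ℝ} {φ' : F →L[ℝ] ℝ} {p : F} (h : HasFDerivAt φ φ' p) {ε : ℝ} (hε : 0 < ε) :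
    ∀ᶠ z in 𝓝 p, |φ z - φ p - φ' (z - p)| ≤ ε * ‖z - p‖ :=
  h.isLittleO.def hε

/-- Lower slope of the cost in terms of the lower slopes of its nonsmooth parts. -/
theorem eventually_costReal_ge {f : Space n → EReal}
    {g : ∀ i, EuclideanSpace ℝ (Fin (n i)) → EReal} {p : Space n} {κ : ℝ}
    (hf : HasFDerivAt (fun y => (f y).toReal) (innerSL ℝ (grad f p)) p) (hκ : 0 ≤ κ)
    (hg : ∀ i, ∀ ε : ℝ, 0 < ε → ∀ᶠ w in 𝓝 (p i), g i w ≠ ⊤ →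
      (g i (p i)).toReal - inner ℝ (blockGrad f i p) (w - p i) - (κ + ε) * ‖w - p i‖ ≤
        (g i w).toReal) {ε : ℝ} (hε : 0 < ε) :
    ∀ᶠ y in 𝓝 p, (∀ i, g i (y i) ≠ ⊤) →
      costReal f g p - (N * κ + ε) * ‖y - p‖ ≤ costReal f g y := by
  -- One share of the error for each of the N blocks and one for f.
  set e : ℝ := ε / (N + 1) with he
  have he0 : 0 < e := by positivity
  have h1 : ∀ i, ∀ᶠ y in 𝓝 p, g i (y i) ≠ ⊤ →
      (g i (p i)).toReal - inner ℝ (blockGrad f i p) (y i - p i) - (κ + e) * ‖y i - p i‖ ≤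
        (g i (y i)).toReal := fun i =>
    ((PiLp.continuous_apply 2 _ i).tendsto p).eventually (hg i e he0)
  filter_upwards [eventually_all.2 h1, eventually_abs_taylor_le hf he0] with y hy1 hy2 hgy
  have h2 : ∑ i, ((g i (p i)).toReal - inner ℝ (blockGrad f i p) ((y - p) i) -
      (κ + e) * ‖y - p‖) ≤ ∑ i, (g i (y i)).toReal := by
    refine Finset.sum_le_sum fun i _ => le_trans ?_ (hy1 i (hgy i))
    have := mul_le_mul_of_nonneg_left (norm_apply_sub_le y p i) (by positivity : 0 ≤ κ + e)
    rw [PiLp.sub_apply]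
    linarith
  -- The block inner products add up to the linear part of f at p, so the two cancel.
  rw [Finset.sum_sub_distrib, Finset.sum_sub_distrib, ← inner_eq_sum_blockGrad,
    Finset.sum_const, Finset.card_univ, Fintype.card_fin, nsmul_eq_mul] at h2
  have h3 := (abs_le.1 hy2).1
  rw [innerSL_apply_apply] at h3
  have h4 : ε = N * e + e := by rw [he]; field_simp
  rw [costReal, costReal, h4]
  linarith

/-- Lower slope of the Bregman distances in the Lyapunov function. -/
theorem eventually_bregmanReal_mix_ge {h : Space n → EReal} {i : Fin N} {Q : Set (Space n)}
    {K : NNReal} (hQ : Convex ℝ Q)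
    (hd : ∀ y ∈ Q, HasFDerivAt (fun y => (h y).toReal) (innerSL ℝ (grad h y)) y)
    (hL : LipschitzOnWith K (blockGrad h i) Q) {p : WithLp 2 (Space n × Space n)}
    (h0 : mix (i : ℕ) p.fst p.snd ∈ interior Q)
    (h1 : mix ((i : ℕ) + 1) p.fst p.snd ∈ interior Q) {ε : ℝ} (hε : 0 < ε) :
    ∀ᶠ q in 𝓝 p,
      bregmanReal h (mix ((i : ℕ) + 1) p.fst p.snd) (mix (i : ℕ) p.fst p.snd) -
        (6 * K * ‖p.fst - p.snd‖ + ε) * ‖q - p‖ ≤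
      bregmanReal h (mix ((i : ℕ) + 1) q.fst q.snd) (mix (i : ℕ) q.fst q.snd) := by
  have cm : ∀ m, Continuous fun q : WithLp 2 (Space n × Space n) => mix m q.fst q.snd := fun m =>
    (continuous_mix m).comp (by fun_prop : Continuous fun q : WithLp 2 (Space n × Space n) =>
      (q.fst, q.snd))
  have eq : ∀ q : WithLp 2 (Space n × Space n),
      mix ((i : ℕ) + 1) q.fst q.snd = mix (i : ℕ) q.fst q.snd +
        blockIncl i (q.fst i - q.snd i) := fun q => by
    rw [mix_succ, setBlock_eq_add, mix_apply_self]
  have hB : ∀ q : WithLp 2 (Space n × Space n),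
      bregmanReal h (mix ((i : ℕ) + 1) q.fst q.snd) (mix (i : ℕ) q.fst q.snd) =
        blockBregman h i (mix (i : ℕ) q.fst q.snd) (q.fst i - q.snd i) := fun q => by
    rw [mix_succ, bregmanReal_setBlock_eq_blockBregman, mix_apply_self]
  have e0 : ∀ᶠ q in 𝓝 p, mix (i : ℕ) q.fst q.snd ∈ interior Q :=
    (cm _).continuousAt.eventually_mem (isOpen_interior.mem_nhds h0)
  have e1 : ∀ᶠ q in 𝓝 p, mix ((i : ℕ) + 1) q.fst q.snd ∈ interior Q :=
    (cm _).continuousAt.eventually_mem (isOpen_interior.mem_nhds h1)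
  have e2 : ∀ᶠ q in 𝓝 p,
      mix (i : ℕ) q.fst q.snd + blockIncl i (p.fst i - p.snd i) ∈ interior Q := by
    refine ((cm _).add continuous_const).continuousAt.eventually_mem
      (isOpen_interior.mem_nhds ?_)
    have h1' := h1
    rw [eq] at h1'
    exact h1'
  have hr : 0 < ε / (4 * K + 1) := by positivity
  have e3 : ∀ᶠ q in 𝓝 p, q ∈ Metric.ball p (ε / (4 * K + 1)) := Metric.ball_mem_nhds _ hr
  filter_upwards [e0, e1, e2, e3] with q q0 q1 q2 q3
  rw [hB, hB]
  -- First the base point moves with the displacement of p fixed, then the displacement moves. The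
  -- two changes contribute 4 and 2 to the constant 6.
  have b1 := abs_blockBregman_sub_base_le hQ hd hL (s := p.fst i - p.snd i)
    (interior_subset q0) (interior_subset h0) (interior_subset q2)
    (by rw [← eq]; exact interior_subset h1)
  have b2 := abs_blockBregman_sub_disp_le hQ hd hL (s := q.fst i - q.snd i)
    (s' := p.fst i - p.snd i) (interior_subset q0) (by rw [← eq]; exact interior_subset q1)
    (interior_subset q2)
  have n1 : ‖q.fst - p.fst‖ ≤ ‖q - p‖ := WithLp.norm_fst_le _ (q - p)
  have n2 : ‖q.snd - p.snd‖ ≤ ‖q - p‖ := WithLp.norm_snd_le _ (q - p)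
  have n3 := norm_mix_sub_le (i : ℕ) q.fst q.snd p.fst p.snd
  have n4 : ‖p.fst i - p.snd i‖ ≤ ‖p.fst - p.snd‖ := norm_apply_sub_le _ _ _
  have n5 : ‖q.fst i - q.snd i - (p.fst i - p.snd i)‖ ≤ 2 * ‖q - p‖ := by
    have : q.fst i - q.snd i - (p.fst i - p.snd i) =
        (q.fst i - p.fst i) - (q.snd i - p.snd i) := by abel
    rw [this]
    refine (norm_sub_le _ _).trans ?_
    linarith [norm_apply_sub_le q.fst p.fst i, norm_apply_sub_le q.snd p.snd i]
  have n6 : (4 * K + 1) * ‖q - p‖ ≤ ε := by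
    rw [Metric.mem_ball, dist_eq_norm, lt_div_iff₀ (by positivity)] at q3
    linarith
  have hK : (0 : ℝ) ≤ K := K.2
  have m1 : 2 * K * ‖mix (i : ℕ) q.fst q.snd - mix (i : ℕ) p.fst p.snd‖ * ‖p.fst i - p.snd i‖ ≤
      2 * K * (2 * ‖q - p‖) * ‖p.fst - p.snd‖ := by
    gcongr; linarith
  have m2 : K * (‖p.fst i - p.snd i‖ + ‖q.fst i - q.snd i - (p.fst i - p.snd i)‖) *
      ‖q.fst i - q.snd i - (p.fst i - p.snd i)‖ ≤
      K * (‖p.fst - p.snd‖ + 2 * ‖q - p‖) * (2 * ‖q - p‖) := by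
    gcongr
  have m3 : 4 * K * ‖q - p‖ * ‖q - p‖ ≤ ε * ‖q - p‖ :=
    mul_le_mul_of_nonneg_right (by linarith [norm_nonneg (q - p)]) (norm_nonneg _)
  have a1 := (abs_le.1 b1).1
  have a2 := (abs_le.1 b2).1
  nlinarith

/-- The points stabilize for m ≥ N, so only finitely many open conditions are involved. -/
theorem eventually_mix_mem {p : WithLp 2 (Space n × Space n)} {V : Set (Space n)}
    (hV : IsOpen V) (hm : ∀ m, mix m p.fst p.snd ∈ V) :
    ∀ᶠ q : WithLp 2 (Space n × Space n) in 𝓝 p, ∀ m, mix m q.fst q.snd ∈ V := by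
  have h1 : ∀ᶠ q : WithLp 2 (Space n × Space n) in 𝓝 p, ∀ m : Fin (N + 1),
      mix (m : ℕ) q.fst q.snd ∈ V := by
    refine eventually_all.2 fun m => ?_
    have : Continuous fun q : WithLp 2 (Space n × Space n) => mix (m : ℕ) q.fst q.snd :=
      (continuous_mix _).comp (by fun_prop : Continuous
        fun q : WithLp 2 (Space n × Space n) => (q.fst, q.snd))
    exact this.continuousAt.eventually_mem (hV.mem_nhds (hm _))
  filter_upwards [h1] with q hq m
  rcases le_total m N with hmN | hmN
  · exact hq ⟨m, by omega⟩
  · have := hq ⟨N, by omega⟩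
    rwa [mix_of_le hmN, ← mix_of_le (le_refl N) q.fst q.snd]

end Slopes

namespace Setting

variable [NeZero N] {C : Set (Space n)} {f : Space n → EReal}
  {g : ∀ i, EuclideanSpace ℝ (Fin (n i)) → EReal} {h : Fin N → Space n → EReal}
  {L σ δ : Fin N → ℝ} {γ α : ℕ → Fin N → ℝ} {xm : Space n} {x : ℕ → Space n}

/-! ### Semicontinuity and lower slope of the Lyapunov function -/

section Lyapunov

variable (S : Setting C f g h L σ δ γ α xm x)
include S

theorem bregman_mix_nonneg (i : Fin N) (a b : Space n) :
    0 ≤ bregman (h i) (mix ((i : ℕ) + 1) a b) (mix (i : ℕ) a b) := by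
  by_cases hab : mix ((i : ℕ) + 1) a b ∈ dom (h i) ∧ mix (i : ℕ) a b ∈ interior (dom (h i))
  · rw [bregman_eq_coe hab.1 hab.2, mix_succ]
    have := bregmanReal_setBlock_nonneg (S.basic.h_legendre i).base
      (S.basic.f_relSmooth.kernel i).convex hab.2 (z := a i) (by rw [← mix_succ]; exact hab.1)
    exact_mod_cast this
  · rw [bregman, if_neg hab]; exact le_top

theorem delta_mul_bregman_nonneg (i : Fin N) (a b : Space n) :
    0 ≤ (δ i : EReal) * bregman (h i) (mix ((i : ℕ) + 1) a b) (mix (i : ℕ) a b) :=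
  mul_nonneg (by exact_mod_cast S.delta_nonneg i) (S.bregman_mix_nonneg i a b)

/-- The Bregman terms are nonnegative everywhere, being ∞ where undefined. The bound carries both
infinite values and the zero subgradient from Φ to the Lyapunov function. -/
theorem cost_le_lyapunov (q : WithLp 2 (Space n × Space n)) :
    cost f g q.fst ≤ lyapunov f g h δ q :=
  le_add_of_nonneg_right (Finset.sum_nonneg fun i _ => S.delta_mul_bregman_nonneg i _ _)

theorem lyapunov_eq_coe {q : WithLp 2 (Space n × Space n)}
    (hm : ∀ m, mix m q.fst q.snd ∈ interior (dom (h 0))) (hg : ∀ i, g i (q.fst i) ≠ ⊤) :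
    lyapunov f g h δ q = ((costReal f g q.fst + ∑ i : Fin N, δ i *
      bregmanReal (h i) (mix ((i : ℕ) + 1) q.fst q.snd) (mix (i : ℕ) q.fst q.snd) : ℝ) :
        EReal) := by
  have hx : q.fst ∈ interior (dom (h 0)) := by
    have := hm N; rwa [mix_of_le le_rfl] at this
  rw [lyapunov, cost_eq_coe S.f_proper S.basic.g_proper (S.mem_dom_f hx) hg, EReal.coe_add,
    ← ereal_sum_coe]
  congr 1
  refine Finset.sum_congr rfl fun i _ => ?_
  rw [bregman_eq_coe (S.mem_dom (hm _) i) (S.mem_int (hm _) i), EReal.coe_mul]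

theorem lyapunov_eq_top {q : WithLp 2 (Space n × Space n)} {i : Fin N}
    (hg : g i (q.fst i) = ⊤) : lyapunov f g h δ q = ⊤ := by
  have := S.cost_le_lyapunov q
  rwa [cost_eq_top S.f_proper S.basic.g_proper hg, top_le_iff] at this

theorem continuousOn_bregmanReal_mix (i : Fin N) {B : Set (WithLp 2 (Space n × Space n))}
    (hB : ∀ q ∈ B, ∀ m, mix m q.fst q.snd ∈ interior (dom (h 0))) :
    ContinuousOn (fun q : WithLp 2 (Space n × Space n) => bregmanReal (h i)
      (mix ((i : ℕ) + 1) q.fst q.snd) (mix (i : ℕ) q.fst q.snd)) B := by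
  have hmix : ∀ m, Continuous fun q : WithLp 2 (Space n × Space n) => mix m q.fst q.snd :=
    fun m => (continuous_mix m).comp (by fun_prop : Continuous
      fun q : WithLp 2 (Space n × Space n) => (q.fst, q.snd))
  have hmem : ∀ m, MapsTo (fun q : WithLp 2 (Space n × Space n) => mix m q.fst q.snd)
      B (interior (dom (h 0))) := fun m q hq => hB q hq m
  have c1 := (S.h_contDiffOn i).continuousOn
  have c2 := continuousOn_grad isOpen_interior (S.h_contDiffOn i)
  have d1 := c1.comp (hmix ((i : ℕ) + 1)).continuousOn (hmem _)
  have d2 := c1.comp (hmix (i : ℕ)).continuousOn (hmem _)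
  have d3 := c2.comp (hmix (i : ℕ)).continuousOn (hmem _)
  have d4 := ((hmix ((i : ℕ) + 1)).sub (hmix (i : ℕ))).continuousOn (s := B)
  exact (d1.sub d2).sub (ContinuousOn.inner (𝕜 := ℝ) d3 d4)

/-- Where all intermediate points are interior, the Bregman part is a continuous real function. This
local statement is enough for the slope criterion. -/
theorem lowerSemicontinuousOn_lyapunov {B : Set (WithLp 2 (Space n × Space n))}
    (hB : ∀ q ∈ B, ∀ m, mix m q.fst q.snd ∈ interior (dom (h 0))) :
    LowerSemicontinuousOn (lyapunov f g h δ) B := by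
  have hfst : Continuous fun q : WithLp 2 (Space n × Space n) => q.fst := by fun_prop
  have hcost : LowerSemicontinuousOn (fun q : WithLp 2 (Space n × Space n) => cost f g q.fst)
      B :=
    ((lowerSemicontinuous_cost S.f_proper S.basic.g_proper S.basic.f_relSmooth.lsc
      S.basic.g_lsc).comp hfst).lowerSemicontinuousOn _
  have hsum : LowerSemicontinuousOn (fun q : WithLp 2 (Space n × Space n) =>
      ((∑ i : Fin N, δ i * bregmanReal (h i) (mix ((i : ℕ) + 1) q.fst q.snd)
        (mix (i : ℕ) q.fst q.snd) : ℝ) : EReal)) B := by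
    refine ContinuousOn.lowerSemicontinuousOn
      (continuous_coe_real_ereal.comp_continuousOn ?_)
    exact continuousOn_finsetSum _ fun i _ =>
      continuousOn_const.mul (S.continuousOn_bregmanReal_mix i hB)
  have hadd : LowerSemicontinuousOn (fun q : WithLp 2 (Space n × Space n) =>
      cost f g q.fst + ((∑ i : Fin N, δ i * bregmanReal (h i) (mix ((i : ℕ) + 1) q.fst q.snd)
        (mix (i : ℕ) q.fst q.snd) : ℝ) : EReal)) B :=
    hcost.add' hsum fun q _ =>
      EReal.continuousAt_add (Or.inr (EReal.coe_ne_bot _)) (Or.inr (EReal.coe_ne_top _))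
  have heq : ∀ q ∈ B, lyapunov f g h δ q = cost f g q.fst +
      ((∑ i : Fin N, δ i * bregmanReal (h i) (mix ((i : ℕ) + 1) q.fst q.snd)
        (mix (i : ℕ) q.fst q.snd) : ℝ) : EReal) := fun q hq => by
    rw [lyapunov, ← ereal_sum_coe]
    congr 1
    refine Finset.sum_congr rfl fun i _ => ?_
    rw [bregman_eq_coe (S.mem_dom (hB q hq _) i) (S.mem_int (hB q hq _) i), EReal.coe_mul]
  intro q hq a ha
  rw [heq q hq] at ha
  filter_upwards [hadd q hq a ha, self_mem_nhdsWithin] with w hw hwB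
  rwa [heq w hwB]

theorem exists_lowerSemicontinuousOn_lyapunov {p : WithLp 2 (Space n × Space n)}
    (hm : ∀ m, mix m p.fst p.snd ∈ interior (dom (h 0))) :
    ∃ r : ℝ, 0 < r ∧ LowerSemicontinuousOn (lyapunov f g h δ) (Metric.closedBall p r) := by
  obtain ⟨s, hs, hsb⟩ := Metric.eventually_nhds_iff_ball.1
    (eventually_mix_mem isOpen_interior hm)
  exact ⟨s / 2, by positivity, S.lowerSemicontinuousOn_lyapunov fun q hq =>
    hsb q (Metric.closedBall_subset_ball (by linarith) hq)⟩

/-- Lower slope of the Lyapunov function. -/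
theorem eventually_lyapunov_ge {Q : Set (Space n)} {K : NNReal} (hQ : Convex ℝ Q)
    (hQU : Q ⊆ interior (dom (h 0)))
    (hhL : ∀ i, LipschitzOnWith K (blockGrad (h i) i) Q)
    {p : WithLp 2 (Space n × Space n)} (hm : ∀ m, mix m p.fst p.snd ∈ interior Q) {κ : ℝ}
    (hκ : 0 ≤ κ)
    (hg : ∀ i, ∀ ε : ℝ, 0 < ε → ∀ᶠ w in 𝓝 (p.fst i), g i w ≠ ⊤ →
      (g i (p.fst i)).toReal - inner ℝ (blockGrad f i p.fst) (w - p.fst i) -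
        (κ + ε) * ‖w - p.fst i‖ ≤ (g i w).toReal) {ε : ℝ} (hε : 0 < ε) :
    ∀ᶠ q in 𝓝 p, (((costReal f g p.fst + ∑ i : Fin N, δ i *
      bregmanReal (h i) (mix ((i : ℕ) + 1) p.fst p.snd) (mix (i : ℕ) p.fst p.snd)) -
        (N * κ + (∑ i, δ i) * (6 * K * ‖p.fst - p.snd‖) + ε) * ‖q - p‖ : ℝ) : EReal) ≤
      lyapunov f g h δ q := by
  have hU : ∀ m, mix m p.fst p.snd ∈ interior (dom (h 0)) := fun m =>
    hQU (interior_subset (hm m))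
  have hpU : p.fst ∈ interior (dom (h 0)) := by
    have := hU N; rwa [mix_of_le le_rfl] at this
  have hδ : 0 ≤ ∑ i, δ i := Finset.sum_nonneg fun i _ => S.delta_nonneg i
  -- Half of ε goes to the cost; the Bregman errors, weighted by the δ i, share the other half. The
  -- summand 1 covers the case that all δ i vanish.
  set e : ℝ := ε / (2 * (∑ i, δ i + 1)) with he
  have he0 : 0 < e := by positivity
  have he1 : (∑ i, δ i) * e ≤ ε / 2 := by
    have : (∑ i, δ i + 1) * e = ε / 2 := by rw [he]; field_simp
    linarith
  have h1 : ∀ᶠ q : WithLp 2 (Space n × Space n) in 𝓝 p, (∀ i, g i (q.fst i) ≠ ⊤) →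
      costReal f g p.fst - (N * κ + ε / 2) * ‖q.fst - p.fst‖ ≤ costReal f g q.fst :=
    ((by fun_prop : Continuous fun q : WithLp 2 (Space n × Space n) => q.fst).tendsto
      p).eventually (eventually_costReal_ge (S.f_hasFDerivAt hpU) hκ hg (half_pos hε))
  have h2 : ∀ i : Fin N, _ := fun i => eventually_bregmanReal_mix_ge (h := h i) (i := i) hQ
    (fun y hy => S.h_hasFDerivAt i (hQU hy)) (hhL i) (hm i) (hm (i + 1)) he0
  filter_upwards [h1, eventually_all.2 h2, eventually_mix_mem isOpen_interior hU]
    with q q1 q2 q3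
  by_cases hgq : ∀ i, g i (q.fst i) ≠ ⊤
  · rw [S.lyapunov_eq_coe q3 hgq, EReal.coe_le_coe_iff]
    have n1 : ‖q.fst - p.fst‖ ≤ ‖q - p‖ := WithLp.norm_fst_le _ (q - p)
    have s1 := q1 hgq
    have s2 := Finset.sum_le_sum fun (i : Fin N) (_ : i ∈ Finset.univ) =>
      mul_le_mul_of_nonneg_left (q2 i) (S.delta_nonneg i)
    simp only [mul_sub, Finset.sum_sub_distrib] at s2
    rw [← Finset.sum_mul] at s2
    have s3 := mul_le_mul_of_nonneg_left n1 (by positivity : 0 ≤ N * κ + ε / 2)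
    have s4 := mul_le_mul_of_nonneg_right he1 (norm_nonneg (q - p))
    linarith
  · push Not at hgq
    obtain ⟨i, hi⟩ := hgq
    rw [S.lyapunov_eq_top hi]
    exact le_top

end Lyapunov

/-! ### Slope bounds at the iterates -/

section Iterates

variable (S : Setting C f g h L σ δ γ α xm x)
include S

/-- The bounded part of C has a compact convex closure inside the open domain, and a small closed
thickening keeps all three properties. Compactness makes the Lipschitz constant uniform; convexity
is needed for the mean value estimates. The radius R + R is the norm bound for mixed points. -/
theorem exists_lipschitz_nhd
    (hfLip : ∀ i, LocallyLipschitzOn (interior (dom (h 0))) (blockGrad f i))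
    (hhLip : ∀ i, LocallyLipschitzOn (interior (dom (h 0))) (blockGrad (h i) i))
    (hbdd : Bornology.IsBounded (range x)) :
    ∃ (Q : Set (Space n)) (K : NNReal), Convex ℝ Q ∧ Q ⊆ interior (dom (h 0)) ∧
      (∀ i, LipschitzOnWith K (blockGrad f i) Q) ∧
      (∀ i, LipschitzOnWith K (blockGrad (h i) i) Q) ∧
      ∀ k m, mix m (x (k + 2)) (x (k + 1)) ∈ interior Q := by
  obtain ⟨R, hR⟩ := hbdd.exists_norm_le
  set C₀ := C ∩ Metric.closedBall 0 (R + R) with hC₀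
  have hcomp : IsCompact (closure C₀) :=
    (Metric.isBounded_closedBall.subset inter_subset_right).isCompact_closure
  have hconv : Convex ℝ (closure C₀) :=
    (S.basic.C_convex.inter (convex_closedBall _ _)).closure
  obtain ⟨r, hr, hrU⟩ := hcomp.exists_cthickening_subset_open isOpen_interior
    ((closure_mono inter_subset_left).trans S.closure_subset)
  have hQc : IsCompact (Metric.cthickening r (closure C₀)) := hcomp.cthickening
  have h1 : ∀ i, ∃ K, LipschitzOnWith K (blockGrad f i) (Metric.cthickening r (closure C₀)) :=
    fun i => ((hfLip i).mono hrU).exists_lipschitzOnWith_of_compact hQc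
  have h2 : ∀ i, ∃ K, LipschitzOnWith K (blockGrad (h i) i)
      (Metric.cthickening r (closure C₀)) :=
    fun i => ((hhLip i).mono hrU).exists_lipschitzOnWith_of_compact hQc
  choose K₁ hK₁ using h1
  choose K₂ hK₂ using h2
  refine ⟨Metric.cthickening r (closure C₀), Finset.univ.sup K₁ ⊔ Finset.univ.sup K₂,
    hconv.cthickening r, hrU,
    fun i => (hK₁ i).weaken ((Finset.le_sup (Finset.mem_univ i)).trans le_sup_left),
    fun i => (hK₂ i).weaken ((Finset.le_sup (Finset.mem_univ i)).trans le_sup_right),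
    fun k m => ?_⟩
  have hmem : mix m (x (k + 2)) (x (k + 1)) ∈ closure C₀ := by
    refine subset_closure ⟨S.mix_mem_C k m, ?_⟩
    rw [mem_closedBall_zero_iff]
    exact (norm_mix_le _ _ _).trans (add_le_add (hR _ (mem_range_self _)) (hR _ (mem_range_self _)))
  exact Metric.thickening_subset_interior_cthickening _ _
    (Metric.self_subset_thickening hr _ hmem)

/-- Lower slope of `g_i` at the iterates. -/
theorem eventually_g_ge {Q : Set (Space n)} {K : NNReal} {c A : ℝ}
    (hQU : Q ⊆ interior (dom (h 0))) (hfL : ∀ i, LipschitzOnWith K (blockGrad f i) Q)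
    (hhL : ∀ i, LipschitzOnWith K (blockGrad (h i) i) Q)
    (hmQ : ∀ k m, mix m (x (k + 2)) (x (k + 1)) ∈ interior Q) (hc : 0 < c)
    (hcγ : ∀ k i, 1 / γ k i ≤ c) (hA : ∀ k i, |α k i / γ k i| ≤ A) (k : ℕ) (i : Fin N)
    {ε : ℝ} (hε : 0 < ε) :
    ∀ᶠ w in 𝓝 (x (k + 2) i), g i w ≠ ⊤ →
      (g i (x (k + 2) i)).toReal - inner ℝ (blockGrad f i (x (k + 2))) (w - x (k + 2) i) -
        ((K + c * K) * ‖x (k + 2) - x (k + 1)‖ + A * ‖x (k + 1) - x k‖ + ε) *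
          ‖w - x (k + 2) i‖ ≤ (g i w).toReal := by
  set u := mix (i : ℕ) (x (k + 2)) (x (k + 1)) with hu
  set v := mix ((i : ℕ) + 1) (x (k + 2)) (x (k + 1)) with hv
  set z := x (k + 2) i with hz
  have hvu : v = setBlock u i z := mix_succ i _ _
  have hvw : ∀ w, setBlock v i w = setBlock u i w := fun w => by rw [hvu, setBlock_setBlock]
  have hvi : v i = z := by rw [hvu, setBlock_apply_self]
  have hui : u i = x (k + 1) i := mix_apply_self i _ _
  have huQ : u ∈ Q := interior_subset (hmQ k _)
  have hvQ : v ∈ Q := interior_subset (hmQ k _)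
  have hxQ : x (k + 2) ∈ Q := by
    have := interior_subset (hmQ k N); rwa [mix_of_le le_rfl] at this
  have hvz : setBlock v i z = v := by rw [← hvi, setBlock_self]
  have hslice := hasFDerivAt_slice (φ := h i) (i := i) (x := v) (z := z)
    (by rw [hvz]; exact S.h_hasFDerivAt i (hQU hvQ))
  -- The accuracy ε / c becomes ε after multiplication by 1/γ ≤ c.
  have h1 := eventually_abs_taylor_le hslice (div_pos hε hc)
  rw [hvz] at h1
  have h2 : ∀ᶠ w in 𝓝 z, setBlock v i w ∈ interior (dom (h 0)) := by
    have hcont : Continuous fun w => setBlock v i w :=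
      (continuous_setBlock i).comp (by fun_prop : Continuous fun w => (v, w))
    refine hcont.continuousAt.eventually_mem (isOpen_interior.mem_nhds ?_)
    rw [hvz]; exact hQU hvQ
  filter_upwards [h1, h2] with w w1 w2 hgw
  have hst := S.step_ineq k i (w := w) (by rw [← hu, ← hvw]; exact w2) hgw
  rw [← hu, ← hv, ← hz] at hst
  rw [innerSL_apply_apply, hvw] at w1
  -- The difference is the Taylor remainder of h_i at the updated point v plus the inner product of
  -- ∇_i h_i(v) - ∇_i h_i(u) with w - z.
  have hD : bregmanReal (h i) (setBlock u i w) u - bregmanReal (h i) v u ≤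
      (K * ‖x (k + 2) - x (k + 1)‖ + ε / c) * ‖w - z‖ := by
    have e1 : bregmanReal (h i) (setBlock u i w) u - bregmanReal (h i) v u =
        ((h i (setBlock u i w)).toReal - (h i v).toReal -
          inner ℝ (blockGrad (h i) i v) (w - z)) +
        inner ℝ (blockGrad (h i) i v - blockGrad (h i) i u) (w - z) := by
      have e3 : bregmanReal (h i) v u = (h i v).toReal - (h i u).toReal -
          inner ℝ (blockGrad (h i) i u) (z - u i) := by
        rw [hvu, bregmanReal_setBlock]
      rw [bregmanReal_setBlock, e3]
      simp only [inner_sub_left, inner_sub_right]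
      ring
    have e2 : ‖blockGrad (h i) i v - blockGrad (h i) i u‖ ≤ K * ‖x (k + 2) - x (k + 1)‖ := by
      refine ((hhL i).norm_sub_le hvQ huQ).trans (mul_le_mul_of_nonneg_left ?_ K.2)
      rw [hvu, norm_setBlock_sub_self, hui]
      exact norm_apply_sub_le _ _ _
    have e4 := (real_inner_le_norm (blockGrad (h i) i v - blockGrad (h i) i u) (w - z)).trans
      (mul_le_mul_of_nonneg_right e2 (norm_nonneg _))
    rw [e1, add_mul]
    linarith [le_abs_self ((h i (setBlock u i w)).toReal - (h i v).toReal -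
          inner ℝ (blockGrad (h i) i v) (w - z))]
  have hγ := S.gamma_pos (k + 1) i
  have hD2 : 1 / γ (k + 1) i * (bregmanReal (h i) (setBlock u i w) u - bregmanReal (h i) v u) ≤
      (c * K * ‖x (k + 2) - x (k + 1)‖ + ε) * ‖w - z‖ := by
    have e1 := mul_le_mul_of_nonneg_left hD (by positivity : 0 ≤ 1 / γ (k + 1) i)
    have e2 := mul_le_mul_of_nonneg_right (hcγ (k + 1) i)
      (by positivity : 0 ≤ (K * ‖x (k + 2) - x (k + 1)‖ + ε / c) * ‖w - z‖)
    have e3 : c * ((K * ‖x (k + 2) - x (k + 1)‖ + ε / c) * ‖w - z‖) =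
        (c * K * ‖x (k + 2) - x (k + 1)‖ + ε) * ‖w - z‖ := by field_simp
    linarith
  -- The gradient of f at the intermediate point is exchanged for the one at the full new iterate,
  -- the point where the Lyapunov function is differentiated.
  have hF : inner ℝ (blockGrad f i u - (α (k + 1) i / γ (k + 1) i) • (x (k + 1) i - x k i))
      (w - z) ≤ inner ℝ (blockGrad f i (x (k + 2))) (w - z) +
        (K * ‖x (k + 2) - x (k + 1)‖ + A * ‖x (k + 1) - x k‖) * ‖w - z‖ := by
    have e1 : ‖blockGrad f i u - blockGrad f i (x (k + 2))‖ ≤ K * ‖x (k + 2) - x (k + 1)‖ :=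
      ((hfL i).norm_sub_le huQ hxQ).trans
        (mul_le_mul_of_nonneg_left (norm_mix_sub_left_le _ _ _) K.2)
    have e2 : ‖(α (k + 1) i / γ (k + 1) i) • (x (k + 1) i - x k i)‖ ≤
        A * ‖x (k + 1) - x k‖ := by
      rw [norm_smul, Real.norm_eq_abs]
      exact mul_le_mul (hA _ _) (norm_apply_sub_le _ _ _) (norm_nonneg _)
        ((abs_nonneg _).trans (hA 0 i))
    have e3 := (real_inner_le_norm (blockGrad f i u - blockGrad f i (x (k + 2)) -
      (α (k + 1) i / γ (k + 1) i) • (x (k + 1) i - x k i)) (w - z)).trans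
      (mul_le_mul_of_nonneg_right ((norm_sub_le _ _).trans (add_le_add e1 e2)) (norm_nonneg _))
    simp only [inner_sub_left] at e3 ⊢
    linarith
  have hw : w - x (k + 1) i = (w - z) + (z - x (k + 1) i) := by abel
  rw [hw, inner_add_right] at hst
  rw [mul_sub] at hD2
  linarith

end Iterates

end Setting

theorem eventually_lt_toReal_of_lsc {X : Type*} [TopologicalSpace X] {φ : X → EReal}
    (hφ : LowerSemicontinuous φ) {p : X} {a : ℝ} (ha : (a : EReal) < φ p) :
    ∀ᶠ z in 𝓝 p, φ z ≠ ⊤ → a < (φ z).toReal := by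
  filter_upwards [hφ p a ha] with z hz hzt
  rw [← EReal.coe_toReal hzt (ne_bot_of_gt hz)] at hz
  exact_mod_cast hz

/-! ### Limits of the subproblems at cluster points -/

namespace Setting

variable [NeZero N] {C : Set (Space n)} {f : Space n → EReal}
  {g : ∀ i, EuclideanSpace ℝ (Fin (n i)) → EReal} {h : Fin N → Space n → EReal}
  {L σ δ : Fin N → ℝ} {γ α : ℕ → Fin N → ℝ} {xm : Space n} {x : ℕ → Space n}
  (S : Setting C f g h L σ δ γ α xm x)
include S

/-- Upper bound on `g_i` at the iterates by its values at other points. -/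
theorem g_le {c A : ℝ} (hcγ : ∀ k i, 1 / γ k i ≤ c) (hA : ∀ k i, |α k i / γ k i| ≤ A)
    (k : ℕ) (i : Fin N) {w : EuclideanSpace ℝ (Fin (n i))}
    (hw : setBlock (mix i (x (k + 2)) (x (k + 1))) i w ∈ interior (dom (h 0)))
    (hgw : g i w ≠ ⊤) :
    (g i (x (k + 2) i)).toReal ≤
      inner ℝ (blockGrad f i (mix i (x (k + 2)) (x (k + 1)))) (w - x (k + 2) i) +
      A * ‖x (k + 1) - x k‖ * ‖w - x (k + 2) i‖ +
      c * bregmanReal (h i) (setBlock (mix i (x (k + 2)) (x (k + 1))) i w)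
        (mix i (x (k + 2)) (x (k + 1))) + (g i w).toReal := by
  have h1 := S.step_ineq k i hw hgw
  set u := mix (i : ℕ) (x (k + 2)) (x (k + 1)) with hu
  have hγ := S.gamma_pos (k + 1) i
  have h2 : 0 ≤ bregmanReal (h i) (setBlock u i w) u :=
    bregmanReal_setBlock_nonneg (S.basic.h_legendre i).base
      (S.basic.f_relSmooth.kernel i).convex (S.mem_int (S.mix_mem_int (k + 1) i) i)
      (S.mem_dom hw i)
  have h3 : 0 ≤ 1 / γ (k + 1) i *
      bregmanReal (h i) (mix ((i : ℕ) + 1) (x (k + 2)) (x (k + 1))) u :=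
    mul_nonneg (by positivity) (S.stepBregman_nonneg (k + 1) i)
  have h4 := mul_le_mul_of_nonneg_right (hcγ (k + 1) i) h2
  have h5 : ‖(α (k + 1) i / γ (k + 1) i) • (x (k + 1) i - x k i)‖ ≤ A * ‖x (k + 1) - x k‖ := by
    rw [norm_smul, Real.norm_eq_abs]
    exact mul_le_mul (hA _ _) (norm_apply_sub_le _ _ _) (norm_nonneg _)
      ((abs_nonneg _).trans (hA 0 i))
  have h6 := (abs_real_inner_le_norm ((α (k + 1) i / γ (k + 1) i) • (x (k + 1) i - x k i))
    (w - x (k + 2) i)).trans (mul_le_mul_of_nonneg_right h5 (norm_nonneg _))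
  have h7 := neg_le_of_abs_le h6
  have hw' : w - x (k + 1) i = (w - x (k + 2) i) + (x (k + 2) i - x (k + 1) i) := by abel
  rw [hw', inner_add_right, inner_sub_left _ _ (w - x (k + 2) i)] at h1
  linarith

section Cluster

variable {s : ℕ → ℕ} {xs : Space n}

theorem tendsto_shift (hs : Tendsto s atTop atTop) (hxs : Tendsto (x ∘ s) atTop (𝓝 xs)) (i : ℕ) :
    Tendsto (fun j => x (s j + i)) atTop (𝓝 xs) := by
  induction i with
  | zero => exact hxs
  | succ i ih =>
    have h1 : Tendsto (fun j => x (s j + i + 1) - x (s j + i)) atTop (𝓝 0) :=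
      tendsto_zero_iff_norm_tendsto_zero.2
        (S.tendsto_step_zero.comp ((tendsto_add_atTop_nat i).comp hs))
    have := ih.add h1
    rw [add_zero] at this
    refine this.congr fun j => ?_
    rw [add_sub_cancel, add_assoc]

theorem tendsto_mix (hs : Tendsto s atTop atTop) (hxs : Tendsto (x ∘ s) atTop (𝓝 xs)) (m : ℕ) :
    Tendsto (fun j => mix m (x (s j + 2)) (x (s j + 1))) atTop (𝓝 xs) := by
  have := ((continuous_mix m).tendsto (xs, xs)).comp
    ((S.tendsto_shift hs hxs 2).prodMk_nhds (S.tendsto_shift hs hxs 1))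
  simpa only [mix_self, Function.comp_def] using this

theorem cluster_mem (hs : Tendsto s atTop atTop) (hxs : Tendsto (x ∘ s) atTop (𝓝 xs)) :
    xs ∈ interior (dom (h 0)) :=
  S.closure_subset (mem_closure_of_tendsto (S.tendsto_shift hs hxs 1)
    (Eventually.of_forall fun j => S.iterate_mem_C (s j)))

/-- The inertial term disappears because the steps tend to 0, and every intermediate point converges
to the same cluster point. -/
theorem tendsto_bound {c A : ℝ} (hs : Tendsto s atTop atTop)
    (hxs : Tendsto (x ∘ s) atTop (𝓝 xs)) (i : Fin N) {w : EuclideanSpace ℝ (Fin (n i))}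
    (hw : setBlock xs i w ∈ interior (dom (h 0))) :
    Tendsto (fun j =>
      inner ℝ (blockGrad f i (mix i (x (s j + 2)) (x (s j + 1)))) (w - x (s j + 2) i) +
      A * ‖x (s j + 1) - x (s j)‖ * ‖w - x (s j + 2) i‖ +
      c * bregmanReal (h i) (setBlock (mix i (x (s j + 2)) (x (s j + 1))) i w)
        (mix i (x (s j + 2)) (x (s j + 1))) + (g i w).toReal) atTop
      (𝓝 (inner ℝ (blockGrad f i xs) (w - xs i) +
        c * bregmanReal (h i) (setBlock xs i w) xs + (g i w).toReal)) := by
  have hU := S.cluster_mem hs hxs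
  have tu := S.tendsto_mix hs hxs i
  have tz : Tendsto (fun j => w - x (s j + 2) i) atTop (𝓝 (w - xs i)) :=
    tendsto_const_nhds.sub
      (((PiLp.continuous_apply 2 _ i).tendsto xs).comp (S.tendsto_shift hs hxs 2))
  have td : Tendsto (fun j => ‖x (s j + 1) - x (s j)‖) atTop (𝓝 0) := S.tendsto_step_zero.comp hs
  have tv : Tendsto (fun j => setBlock (mix i (x (s j + 2)) (x (s j + 1))) i w) atTop
      (𝓝 (setBlock xs i w)) :=
    ((continuous_setBlock i).tendsto (xs, w)).comp (tu.prodMk_nhds tendsto_const_nhds)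
  have nU := isOpen_interior.mem_nhds hU
  have c1 := ((continuousOn_blockGrad isOpen_interior S.basic.f_contDiffOn i).continuousAt nU).tendsto.comp tu
  have c2 := (((S.h_contDiffOn i).continuousOn.continuousAt (isOpen_interior.mem_nhds hw)).tendsto).comp tv
  have c3 := (((S.h_contDiffOn i).continuousOn.continuousAt nU).tendsto).comp tu
  have c4 := ((continuousOn_grad isOpen_interior (S.h_contDiffOn i)).continuousAt nU).tendsto.comp tu
  have cD : Tendsto (fun j => bregmanReal (h i) (setBlock (mix i (x (s j + 2)) (x (s j + 1))) i w)
        (mix i (x (s j + 2)) (x (s j + 1)))) atTop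
        (𝓝 (bregmanReal (h i) (setBlock xs i w) xs)) :=
    (c2.sub c3).sub (c4.inner (tv.sub tu))
  have := (((c1.inner (𝕜 := ℝ) tz).add ((td.const_mul A).mul tz.norm)).add
    (cD.const_mul c)).add_const (g i w).toReal
  simp only [mul_zero, zero_mul, add_zero] at this
  exact this

/-- Stated with a real a below g_i(xs_i) because finiteness of that value is not yet known; lower
semicontinuity puts the values at the iterates above a eventually. -/
theorem cluster_ineq_aux {c A : ℝ} (hcγ : ∀ k i, 1 / γ k i ≤ c)
    (hA : ∀ k i, |α k i / γ k i| ≤ A) (hs : Tendsto s atTop atTop)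
    (hxs : Tendsto (x ∘ s) atTop (𝓝 xs)) (i : Fin N) {w : EuclideanSpace ℝ (Fin (n i))}
    (hw : setBlock xs i w ∈ interior (dom (h 0))) (hgw : g i w ≠ ⊤) {a : ℝ}
    (ha : (a : EReal) < g i (xs i)) :
    a ≤ inner ℝ (blockGrad f i xs) (w - xs i) +
        c * bregmanReal (h i) (setBlock xs i w) xs + (g i w).toReal := by
  refine ge_of_tendsto (S.tendsto_bound (A := A) hs hxs i hw) ?_
  have tz : Tendsto (fun j => x (s j + 2) i) atTop (𝓝 (xs i)) :=
    ((PiLp.continuous_apply 2 _ i).tendsto xs).comp (S.tendsto_shift hs hxs 2)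
  have tv : Tendsto (fun j => setBlock (mix i (x (s j + 2)) (x (s j + 1))) i w) atTop
      (𝓝 (setBlock xs i w)) :=
    ((continuous_setBlock i).tendsto (xs, w)).comp
      ((S.tendsto_mix hs hxs i).prodMk_nhds tendsto_const_nhds)
  filter_upwards [tz.eventually (eventually_lt_toReal_of_lsc (S.basic.g_lsc i) ha),
    tv.eventually (isOpen_interior.mem_nhds hw)] with j hj1 hj2
  exact (hj1 (S.g_ne_top (s j + 1) i)).le.trans (S.g_le hcγ hA (s j) i hj2 hgw)

/-- Otherwise every real a would lie below one fixed real bound, obtained by testing with the block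
of a late iterate, where g_i is finite. -/
theorem g_cluster_ne_top {c A : ℝ} (hcγ : ∀ k i, 1 / γ k i ≤ c)
    (hA : ∀ k i, |α k i / γ k i| ≤ A) (hs : Tendsto s atTop atTop)
    (hxs : Tendsto (x ∘ s) atTop (𝓝 xs)) (i : Fin N) : g i (xs i) ≠ ⊤ := by
  intro htop
  have tv : Tendsto (fun j => setBlock xs i (x (s j + 1) i)) atTop (𝓝 xs) := by
    have := ((continuous_setBlock i).tendsto (xs, xs i)).comp (tendsto_const_nhds.prodMk_nhds
      (((PiLp.continuous_apply 2 _ i).tendsto xs).comp (S.tendsto_shift hs hxs 1)))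
    simpa only [setBlock_self, Function.comp_def] using this
  obtain ⟨j, hj⟩ := (tv.eventually (isOpen_interior.mem_nhds (S.cluster_mem hs hxs))).exists
  have := fun a : ℝ => S.cluster_ineq_aux hcγ hA hs hxs i hj (S.g_ne_top (s j) i) (a := a)
    (by rw [htop]; exact EReal.coe_lt_top a)
  exact absurd (this _) (not_le.2 (lt_add_one _))

theorem cluster_ineq {c A : ℝ} (hcγ : ∀ k i, 1 / γ k i ≤ c)
    (hA : ∀ k i, |α k i / γ k i| ≤ A) (hs : Tendsto s atTop atTop)
    (hxs : Tendsto (x ∘ s) atTop (𝓝 xs)) (i : Fin N) {w : EuclideanSpace ℝ (Fin (n i))}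
    (hw : setBlock xs i w ∈ interior (dom (h 0))) (hgw : g i w ≠ ⊤) :
    (g i (xs i)).toReal ≤ inner ℝ (blockGrad f i xs) (w - xs i) +
        c * bregmanReal (h i) (setBlock xs i w) xs + (g i w).toReal := by
  refine le_of_forall_lt_imp_le_of_dense fun a ha =>
    S.cluster_ineq_aux hcγ hA hs hxs i hw hgw ?_
  rw [← EReal.coe_toReal (S.g_cluster_ne_top hcγ hA hs hxs i) ((S.basic.g_proper i).1 _)]
  exact_mod_cast ha

/-- At the limit the Bregman term is the first-order Taylor remainder of h_i, hence o(‖w - xs_i‖).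
The slope is 0, written 0 + ε to match `eventually_costReal_ge`. -/
theorem eventually_g_cluster_ge {c A : ℝ} (hc : 0 < c) (hcγ : ∀ k i, 1 / γ k i ≤ c)
    (hA : ∀ k i, |α k i / γ k i| ≤ A) (hs : Tendsto s atTop atTop)
    (hxs : Tendsto (x ∘ s) atTop (𝓝 xs)) (i : Fin N) {ε : ℝ} (hε : 0 < ε) :
    ∀ᶠ w in 𝓝 (xs i), g i w ≠ ⊤ →
      (g i (xs i)).toReal - inner ℝ (blockGrad f i xs) (w - xs i) - (0 + ε) * ‖w - xs i‖ ≤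
        (g i w).toReal := by
  have hU := S.cluster_mem hs hxs
  have hslice := hasFDerivAt_slice (φ := h i) (i := i) (x := xs) (z := xs i)
    (by rw [setBlock_self]; exact S.h_hasFDerivAt i hU)
  have h1 := eventually_abs_taylor_le hslice (div_pos hε hc)
  have h2 : ∀ᶠ w in 𝓝 (xs i), setBlock xs i w ∈ interior (dom (h 0)) := by
    have hcont : Continuous fun w => setBlock xs i w :=
      (continuous_setBlock i).comp (by fun_prop : Continuous fun w => (xs, w))
    exact hcont.continuousAt.eventually_mem
      (isOpen_interior.mem_nhds (by rw [setBlock_self]; exact hU))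
  filter_upwards [h1, h2] with w w1 w2 hgw
  have h3 := S.cluster_ineq hcγ hA hs hxs i w2 hgw
  rw [setBlock_self, innerSL_apply_apply] at w1
  have h4 := mul_le_mul_of_nonneg_left ((le_abs_self _).trans w1) hc.le
  rw [bregmanReal_setBlock] at h3
  have h5 : c * (ε / c * ‖w - xs i‖) = ε * ‖w - xs i‖ := by field_simp
  linarith

/-- Lower semicontinuity gives only the lower bound. The upper bound comes from minimality, by
testing the subproblems with w = xs_i. -/
theorem tendsto_g_cluster {c A : ℝ} (hcγ : ∀ k i, 1 / γ k i ≤ c)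
    (hA : ∀ k i, |α k i / γ k i| ≤ A) (hs : Tendsto s atTop atTop)
    (hxs : Tendsto (x ∘ s) atTop (𝓝 xs)) (i : Fin N) :
    Tendsto (fun j => (g i (x (s j + 2) i)).toReal) atTop (𝓝 (g i (xs i)).toReal) := by
  have hU := S.cluster_mem hs hxs
  have hgt := S.g_cluster_ne_top hcγ hA hs hxs i
  have tz : Tendsto (fun j => x (s j + 2) i) atTop (𝓝 (xs i)) :=
    ((PiLp.continuous_apply 2 _ i).tendsto xs).comp (S.tendsto_shift hs hxs 2)
  refine tendsto_order.2 ⟨fun a ha => ?_, fun b hb => ?_⟩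
  · have ha' : (a : EReal) < g i (xs i) := by
      rw [← EReal.coe_toReal hgt ((S.basic.g_proper i).1 _)]; exact_mod_cast ha
    filter_upwards [tz.eventually
      (eventually_lt_toReal_of_lsc (S.basic.g_lsc i) ha')] with j hj
    exact hj (S.g_ne_top (s j + 1) i)
  · have ht := S.tendsto_bound (c := c) (A := A) hs hxs i (w := xs i)
      (by rw [setBlock_self]; exact hU)
    simp only [setBlock_self, sub_self, inner_zero_right, bregmanReal_self, mul_zero,
      zero_add] at ht
    have tv : Tendsto (fun j => setBlock (mix i (x (s j + 2)) (x (s j + 1))) i (xs i)) atTop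
        (𝓝 xs) := by
      have := ((continuous_setBlock i).tendsto (xs, xs i)).comp
        ((S.tendsto_mix hs hxs i).prodMk_nhds tendsto_const_nhds)
      rwa [setBlock_self] at this
    filter_upwards [ht.eventually (gt_mem_nhds hb),
      tv.eventually (isOpen_interior.mem_nhds hU)] with j hj1 hj2
    exact (S.g_le hcγ hA (s j) i hj2 hgt).trans_lt hj1

theorem tendsto_energy_cluster {c A : ℝ} (hcγ : ∀ k i, 1 / γ k i ≤ c)
    (hA : ∀ k i, |α k i / γ k i| ≤ A) (hs : Tendsto s atTop atTop)
    (hxs : Tendsto (x ∘ s) atTop (𝓝 xs)) :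
    Tendsto (fun j => energy f g h δ x (s j + 1)) atTop (𝓝 (costReal f g xs)) := by
  have nU := isOpen_interior.mem_nhds (S.cluster_mem hs hxs)
  have c1 := (S.basic.f_contDiffOn.continuousOn.continuousAt nU).tendsto.comp
    (S.tendsto_shift hs hxs 2)
  have c2 := tendsto_finsetSum (Finset.univ : Finset (Fin N))
    fun i _ => S.tendsto_g_cluster hcγ hA hs hxs i
  have c3 : ∀ i : Fin N, Tendsto (fun j => stepBregman h x (s j + 1) i) atTop (𝓝 0) := fun i => by
    have t0 := S.tendsto_mix hs hxs i
    have t1 := S.tendsto_mix hs hxs (i + 1)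
    have d1 := ((S.h_contDiffOn i).continuousOn.continuousAt nU).tendsto.comp t1
    have d2 := ((S.h_contDiffOn i).continuousOn.continuousAt nU).tendsto.comp t0
    have d3 := ((continuousOn_grad isOpen_interior (S.h_contDiffOn i)).continuousAt nU).tendsto.comp t0
    have := (d1.sub d2).sub (d3.inner (𝕜 := ℝ) (t1.sub t0))
    simp only [sub_self, inner_zero_right] at this
    exact this
  have c4 := tendsto_finsetSum (Finset.univ : Finset (Fin N))
    fun i _ => (c3 i).const_mul (δ i)
  simp only [mul_zero, Finset.sum_const_zero] at c4
  have := (c1.add c2).add c4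
  rwa [add_zero] at this

/-- Every cluster point is stationary, even in the regular sense, with no use of the KŁ property:
all block slopes vanish. -/
theorem zero_mem_regularSubdiff_cost {c A : ℝ} (hc : 0 < c) (hcγ : ∀ k i, 1 / γ k i ≤ c)
    (hA : ∀ k i, |α k i / γ k i| ≤ A) (hs : Tendsto s atTop atTop)
    (hxs : Tendsto (x ∘ s) atTop (𝓝 xs)) : (0 : Space n) ∈ regularSubdiff (cost f g) xs := by
  have hU := S.cluster_mem hs hxs
  have hcoe : ∀ {y : Space n}, y ∈ interior (dom (h 0)) → (∀ i, g i (y i) ≠ ⊤) →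
      cost f g y = costReal f g y := fun hy hg =>
    cost_eq_coe S.f_proper S.basic.g_proper (S.mem_dom_f hy) hg
  have hxc := hcoe hU (S.g_cluster_ne_top hcγ hA hs hxs)
  refine ⟨by simp [hxc], by simp [hxc], fun ε hε => ?_⟩
  have h1 := eventually_costReal_ge (S.f_hasFDerivAt hU) le_rfl
    (fun i ε hε => S.eventually_g_cluster_ge hc hcγ hA hs hxs i hε) hε
  filter_upwards [h1, isOpen_interior.mem_nhds hU] with y hy1 hy2
  by_cases hgy : ∀ i, g i (y i) ≠ ⊤
  · rw [hxc, hcoe hy2 hgy, EReal.toReal_coe, EReal.coe_le_coe_iff, inner_zero_left]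
    have := hy1 hgy
    rw [mul_zero, zero_add] at this
    linarith
  · push Not at hgy
    obtain ⟨i, hi⟩ := hgy
    rw [cost_eq_top S.f_proper S.basic.g_proper hi]
    exact le_top

theorem lyapunov_diag {c A : ℝ} (hcγ : ∀ k i, 1 / γ k i ≤ c)
    (hA : ∀ k i, |α k i / γ k i| ≤ A) (hs : Tendsto s atTop atTop)
    (hxs : Tendsto (x ∘ s) atTop (𝓝 xs)) :
    lyapunov f g h δ (WithLp.toLp 2 (xs, xs)) = (costReal f g xs : ℝ) := by
  rw [S.lyapunov_eq_coe (q := WithLp.toLp 2 (xs, xs))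
    (fun m => by simpa using S.cluster_mem hs hxs)
    (fun i => S.g_cluster_ne_top hcγ hA hs hxs i)]
  simp

/-- The Lyapunov function lies above Φ(x) and agrees with it at the diagonal point, so the regular
subgradient 0 of Φ lifts. This makes the KŁ property available at (xs, xs). -/
theorem zero_mem_subdiff_lyapunov {c A : ℝ} (hc : 0 < c) (hcγ : ∀ k i, 1 / γ k i ≤ c)
    (hA : ∀ k i, |α k i / γ k i| ≤ A) (hs : Tendsto s atTop atTop)
    (hxs : Tendsto (x ∘ s) atTop (𝓝 xs)) :
    0 ∈ subdiff (lyapunov f g h δ) (WithLp.toLp 2 (xs, xs)) := by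
  have hd := S.lyapunov_diag hcγ hA hs hxs
  have hxc : cost f g xs = costReal f g xs :=
    cost_eq_coe S.f_proper S.basic.g_proper (S.mem_dom_f (S.cluster_mem hs hxs))
      (S.g_cluster_ne_top hcγ hA hs hxs)
  refine regularSubdiff_subset_subdiff ⟨by simp [hd], by simp [hd], fun ε hε => ?_⟩
  have h1 := (S.zero_mem_regularSubdiff_cost hc hcγ hA hs hxs).2.2 ε hε
  have hfst : Continuous fun q : WithLp 2 (Space n × Space n) => q.fst := by fun_prop
  have h2 := (hfst.tendsto (WithLp.toLp 2 (xs, xs))).eventually h1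
  filter_upwards [h2] with q hq
  refine le_trans ?_ (hq.trans (S.cost_le_lyapunov q))
  rw [hd, hxc, EReal.toReal_coe, EReal.coe_le_coe_iff, inner_zero_left, inner_zero_left]
  have n1 : ‖q.fst - xs‖ ≤ ‖q - WithLp.toLp 2 (xs, xs)‖ :=
    WithLp.norm_fst_le _ (q - WithLp.toLp 2 (xs, xs))
  have := mul_le_mul_of_nonneg_left n1 hε.le
  linarith

end Cluster

/-! ### The subgradient bound and convergence -/

theorem lyapunov_iterate (k : ℕ) :
    lyapunov f g h δ (WithLp.toLp 2 (x (k + 1), x k)) = (energy f g h δ x k : ℝ) :=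
  S.lyapunov_eq_coe (q := WithLp.toLp 2 (x (k + 1), x k)) (S.mix_mem_int k) (S.g_ne_top k)

theorem exists_step_bounds : ∃ c A : ℝ, 0 < c ∧ (∀ k i, 1 / γ k i ≤ c) ∧
    ∀ k i, |α k i / γ k i| ≤ A := by
  obtain ⟨c, hc, hcl⟩ := S.exists_gamma_low
  have h1 : ∀ k i, 1 / γ k i ≤ 1 / c := fun k i => one_div_le_one_div_of_le hc (hcl k i)
  refine ⟨1 / c, (∑ i, σ i) * (1 / c), by positivity, h1, fun k i => ?_⟩
  have hγ := S.gamma_pos k i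
  have h2 : |α k i| ≤ ∑ i, σ i := by
    have := Finset.single_le_sum (f := σ) (fun j _ => (S.σ_pos j).le) (Finset.mem_univ i)
    linarith [S.param.alpha_lt k i, S.σ_pos i]
  rw [abs_div, abs_of_pos hγ, div_eq_mul_one_div]
  exact mul_le_mul h2 (h1 k i) (by positivity) ((abs_nonneg _).trans h2)

theorem exists_infEDist_le
    (hfLip : ∀ i, LocallyLipschitzOn (interior (dom (h 0))) (blockGrad f i))
    (hhLip : ∀ i, LocallyLipschitzOn (interior (dom (h 0))) (blockGrad (h i) i))
    (hbdd : Bornology.IsBounded (range x)) :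
    ∃ M : ℝ, 0 ≤ M ∧ ∀ k, Metric.infEDist 0
      (subdiff (lyapunov f g h δ) (WithLp.toLp 2 (x (k + 2), x (k + 1)))) ≤
        ENNReal.ofReal (M * (‖x (k + 2) - x (k + 1)‖ + ‖x (k + 1) - x k‖)) := by
  obtain ⟨c, A, hc, hcγ, hA⟩ := S.exists_step_bounds
  obtain ⟨Q, K, hQ, hQU, hfL, hhL, hmQ⟩ := S.exists_lipschitz_nhd hfLip hhLip hbdd
  have hA0 : 0 ≤ A := (abs_nonneg _).trans (hA 0 0)
  have hK : (0 : ℝ) ≤ K := K.2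
  have hδ : 0 ≤ ∑ i, δ i := Finset.sum_nonneg fun i _ => S.delta_nonneg i
  -- The slopes of the N blocks and of the Bregman terms, doubled by the passage from slope to
  -- subgradient.
  refine ⟨2 * (N * (K + c * K + A) + (∑ i, δ i) * (6 * K)), by positivity, fun k => ?_⟩
  obtain ⟨r, hr, hlsc⟩ := S.exists_lowerSemicontinuousOn_lyapunov
    (p := WithLp.toLp 2 (x (k + 2), x (k + 1))) (S.mix_mem_int (k + 1))
  set κ : ℝ := (K + c * K) * ‖x (k + 2) - x (k + 1)‖ + A * ‖x (k + 1) - x k‖ with hκ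
  have hκ0 : 0 ≤ κ := by positivity
  have key := infEDist_subdiff_le hr (κ := N * κ + (∑ i, δ i) *
    (6 * K * ‖x (k + 2) - x (k + 1)‖)) (by positivity) (S.lyapunov_iterate (k + 1)) hlsc
    (fun ε hε => S.eventually_lyapunov_ge hQ hQU hhL
      (p := WithLp.toLp 2 (x (k + 2), x (k + 1))) (hmQ k) hκ0
      (fun i ε hε => S.eventually_g_ge hQU hfL hhL hmQ hc hcγ hA k i hε) hε)
  refine key.trans (ENNReal.ofReal_le_ofReal ?_)
  have h1 : κ ≤ (K + c * K + A) * (‖x (k + 2) - x (k + 1)‖ + ‖x (k + 1) - x k‖) := by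
    rw [hκ]
    have : 0 ≤ (K + c * K) * ‖x (k + 1) - x k‖ + A * ‖x (k + 2) - x (k + 1)‖ := by positivity
    linarith
  have h2 := mul_le_mul_of_nonneg_left h1 (Nat.cast_nonneg (α := ℝ) N)
  have h3 : 0 ≤ (∑ i, δ i) * (6 * K) * ‖x (k + 1) - x k‖ := by positivity
  linarith

theorem summable_and_exists_stationary
    (hfLip : ∀ i, LocallyLipschitzOn (interior (dom (h 0))) (blockGrad f i))
    (hhLip : ∀ i, LocallyLipschitzOn (interior (dom (h 0))) (blockGrad (h i) i))
    (hbdd : Bornology.IsBounded (range x)) (hKL : IsKLFunction (lyapunov f g h δ)) :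
    Summable (fun k => ‖x (k + 1) - x k‖) ∧
      ∃ xs : Space n, Tendsto x atTop (𝓝 xs) ∧ IsStationary (cost f g) xs := by
  obtain ⟨c, A, hc, hcγ, hA⟩ := S.exists_step_bounds
  obtain ⟨xs, -, s, hsm, hxs⟩ := tendsto_subseq_of_bounded hbdd (fun k => mem_range_self k)
  have hs := hsm.tendsto_atTop
  obtain ⟨Es, hEs⟩ := S.exists_energy_lim
  -- The whole energy sequence converges, so its limit can be read off along the subsequence.
  have hEx : Es = costReal f g xs :=
    tendsto_nhds_unique (hEs.comp ((tendsto_add_atTop_nat 1).comp hs))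
      (S.tendsto_energy_cluster hcγ hA hs hxs)
  have hdiag := S.lyapunov_diag hcγ hA hs hxs
  rw [← hEx] at hdiag
  obtain ⟨c', hc', hdec⟩ := S.exists_energy_decrease
  have hsum : Summable (fun k => ‖x (k + 1) - x k‖) := by
    -- The KŁ inequality concerns only values strictly above the limit.
    by_cases hgt : ∀ k, Es < energy f g h δ x k
    · obtain ⟨M, hM, hMk⟩ := S.exists_infEDist_le hfLip hhLip hbdd
      obtain ⟨-, -, η, ε, ψ, hη, hε, hψ, hψ0, -, hψd, -, hψKL⟩ :=
        hKL _ ⟨0, S.zero_mem_subdiff_lyapunov hc hcγ hA hs hxs⟩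
      -- Radius ε/2 for each component keeps the pair within ε of (xs, xs).
      refine summable_of_kl hc' hM hη (half_pos hε) hψ hψ0
        (fun t ht => (hψd.contDiffAt (isOpen_Ioo.mem_nhds ht)).differentiableAt one_ne_zero)
        S.energy_antitone hEs hgt hdec S.tendsto_step_zero hs hxs fun k h2 h1 hη' => ?_
      have hball : WithLp.toLp 2 (x (k + 2), x (k + 1)) ∈
          Metric.ball (WithLp.toLp 2 (xs, xs)) ε := by
        rw [Metric.mem_ball, dist_eq_norm]
        refine lt_of_le_of_lt (abs_le_of_sq_le_sq' (b := ‖x (k + 2) - xs‖ + ‖x (k + 1) - xs‖)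
          ?_ (by positivity)).2 (by linarith)
        rw [WithLp.prod_norm_sq_eq_of_L2]
        have e : ∀ a b : Space n, 0 ≤ 2 * ‖a‖ * ‖b‖ := fun a b => by positivity
        have := e (x (k + 2) - xs) (x (k + 1) - xs)
        change ‖x (k + 2) - xs‖ ^ 2 + ‖x (k + 1) - xs‖ ^ 2 ≤ _
        linarith
      have h3 := hψKL _ hball
      rw [S.lyapunov_iterate (k + 1), hdiag] at h3
      have h4 := h3 (by exact_mod_cast hgt (k + 1)) (by exact_mod_cast hη')
      rw [EReal.toReal_coe, EReal.toReal_coe] at h4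
      have h5 := h4.trans (mul_le_mul_right (hMk k) _)
      rwa [← ENNReal.ofReal_mul' (by positivity), ENNReal.one_le_ofReal] at h5
    -- Once the energy reaches its limit it is constant, and the decrease makes all later steps
    -- zero.
    · push Not at hgt
      obtain ⟨k₀, hk₀⟩ := hgt
      have hge : ∀ k, Es ≤ energy f g h δ x k := fun k =>
        S.energy_antitone.le_of_tendsto hEs k
      refine (summable_nat_add_iff (k₀ + 1)).1 ?_
      refine summable_zero.congr fun k => ?_
      have h1 := hdec (k + k₀)
      have h2 : energy f g h δ x (k + k₀) ≤ energy f g h δ x k₀ := S.energy_antitone (by omega)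
      have h3 := hge (k + k₀ + 2)
      have h4 : ‖x (k + k₀ + 2) - x (k + k₀ + 1)‖ ^ 2 ≤ 0 := by
        by_contra hn
        push Not at hn
        nlinarith
      exact ((pow_eq_zero_iff two_ne_zero).1 (le_antisymm h4 (sq_nonneg _))).symm
  refine ⟨hsum, xs, ?_, regularSubdiff_subset_subdiff
    (S.zero_mem_regularSubdiff_cost hc hcγ hA hs hxs)⟩
  have hcau : CauchySeq x := cauchySeq_of_summable_dist (by
    simpa only [dist_eq_norm, norm_sub_rev] using hsum)
  exact tendsto_nhds_of_cauchySeq_of_subseq hcau hs hxs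

end Setting

end BIBPA

end

theorem mainTheorem1 {N : ℕ} [NeZero N] {n : Fin N → ℕ}
    (C : Set (BIBPA.Space n)) (f : BIBPA.Space n → EReal)
    (g : ∀ i, EuclideanSpace ℝ (Fin (n i)) → EReal) (h : Fin N → BIBPA.Space n → EReal)
    (L σ δ : Fin N → ℝ) (γ α : ℕ → Fin N → ℝ)
    (xm : BIBPA.Space n) (x : ℕ → BIBPA.Space n)
    (hbasic : BIBPA.BasicAssumption C f g h L)
    (hprox : BIBPA.ProxIntoC C f g h L γ α)
    (hC : closure C ⊆ interior (BIBPA.dom (h 0)))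
    (hσ : ∀ i, 0 < σ i)
    (hstrong : ∀ i, BIBPA.IsBlockStrongConvex i (σ i) (h i))
    (hparam : BIBPA.ParamRule L σ δ γ α)
    (hseq : BIBPA.IsBIBPASeq f g h γ α xm x)
    (hfLip : ∀ i, LocallyLipschitzOn (interior (BIBPA.dom (h 0))) (BIBPA.blockGrad f i))
    (hhLip : ∀ i, LocallyLipschitzOn (interior (BIBPA.dom (h 0))) (BIBPA.blockGrad (h i) i))
    (hHess : ∀ i, ∀ y ∈ interior (BIBPA.dom (h 0)),
      DifferentiableAt ℝ (fun z => BIBPA.blockGrad (h i) i (BIBPA.setBlock y i z)) (y i))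
    (hHessBdd : ∀ i, ∀ B : Set (BIBPA.Space n), Bornology.IsBounded B →
      closure B ⊆ interior (BIBPA.dom (h 0)) → ∃ M : ℝ, ∀ y ∈ B, ‖BIBPA.blockHess (h i) i y‖ ≤ M)
    (hbdd : Bornology.IsBounded (Set.range x))
    (hKL : BIBPA.IsKLFunction (BIBPA.lyapunov f g h δ)) :
    (∀ i, Summable (fun k => ‖x (k + 1) i - x k i‖)) ∧
      ∃ xs : BIBPA.Space n, Filter.Tendsto x Filter.atTop (nhds xs) ∧
        BIBPA.IsStationary (BIBPA.cost f g) xs := by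
  have S : BIBPA.Setting C f g h L σ δ γ α xm x :=
    ⟨hbasic, hprox, hC, hσ, hstrong, hparam, hseq⟩
  obtain ⟨hsum, hlim⟩ := S.summable_and_exists_stationary hfLip hhLip hbdd hKL
  exact ⟨fun i => Summable.of_nonneg_of_le (fun _ => norm_nonneg _)
    (fun k => BIBPA.norm_apply_sub_le _ _ i) hsum, hlim⟩
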